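/- Theorem 3. There are absolute constants $c_1,c_2,C>0$ such that the following holds. Let $K\ge 1$, $n_1,\dots,n_K\ge 1$ and $N=\prod_{k=1}^K n_k$. For a tensor $\mathcal W\in\mathbb R^{n_1\times\cdots\times n_K}$ let $W_{(k)}\in\mathbb R^{n_k\times N/n_k}$ be its mode-$k$ unfolding (the columns are the mode-$k$ fibers), let $\langle\mathcal W,\mathcal X\rangle$ be the sum of the entrywise products, $\|\mathcal W\|_{\mathrm F}=\sqrt{\langle\mathcal W,\mathcal W\rangle}$, let $\|\cdot\|_{\mathrm{tr}}$ be the trace norm of a matrix (the sum of its singular values), and define the scaled latent trace norm $$\|\mathcal W\|_{\mathrm{scaled}}=\inf_{\mathcal W^{(1)}+\cdots+\mathcal W^{(K)}=\mathcal W}\ \sum_{k=1}^K\frac1{\sqrt{n_k}}\,\|W^{(k)}_{(k)}\|_{\mathrm{tr}}.$$ Let $\mathrm Y\subseteq\mathbb R$ and let $\mu$ be a probability distribution of a pair $(\mathcal X,y)\in\mathbb R^{n_1\times\cdots\times n_K}\times\mathrm Y$ such that the entries of $\mathcal X$ are independent standard Gaussian variables. Let $l:\mathbb R\times\mathrm Y\to\mathbb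 R$ be a measurable loss function that is $\Lambda$-Lipschitz in its first argument, and suppose that the expected risk $R(\mathcal W)=\mathbb E_{(\mathcal X,y)\sim\mu}\, l(\langle\mathcal W,\mathcal X\rangle,y)$ is finite (that is, $l(\langle\mathcal W,\mathcal X\rangle,y)$ is integrable) for all $\mathcal W$. Let $(\mathcal X_1,y_1),\dots,(\mathcal X_m,y_m)$, $m\ge 1$, be independent samples from $\mu$, and let $\hat R(\mathcal W)=\frac1m\sum_{i=1}^m l(\langle\mathcal W,\mathcal X_i\rangle,y_i)$. Let $\mathcal W^0$ minimize $R$ and let $\hat{\mathcal W}$ minimize $\hat R$, each subject to $\|\mathcal W\|_{\mathrm{scaled}}\le B_0$. Let $r_k$ be the rank of the mode-$k$ unfolding of $\mathcal W^0$, and suppose that $\|\mathcal W^0\|_{\mathrm F}\le B$ and $B_0\le B\sqrt{\min_k (r_k/n_k)}$. Let $0<\delta<1$. If $l$ takes its values in $[0,1]$, then with probability at least $1-\delta$ $$R(\hat{\mathcal W})-R(\mathcal W^0)\le c_1\Lambda B\sqrt{\frac1m\min_k\frac{r_k}{n_k}}\,\Bigl(\max_k\bigl(n_k+\sqrt N\bigr)+C\sqrt{2\log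 K}\Bigr)+c_2\sqrt{\frac{\log(2/\delta)}{2m}} .$$ For an arbitrary (possibly unbounded) $\Lambda$-Lipschitz loss, with probability at least $1-\delta$ the same bound holds with $c_2$ replaced by $c_2\,\Lambda B\sqrt{\max_k n_k}\,\sqrt{\min_k (r_k/n_k)}$. -/

import Mathlib

open MeasureTheory ProbabilityTheory
open scoped NNReal

noncomputable section

namespace TensorLearning

/-- Real `K`-way tensors of size `n 0 × ⋯ × n (K - 1)`. -/
abbrev Tensor {K : ℕ} (n : Fin K → ℕ) : Type := ((k : Fin K) → Fin (n k)) → ℝ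

variable {K : ℕ} {n : Fin K → ℕ}

/-- The inner product `⟨W, X⟩`, the sum of the entrywise products. -/
def tensorInner (W X : Tensor n) : ℝ := ∑ i, W i * X i

/-- The Frobenius norm of a tensor. -/
def frobeniusNorm (W : Tensor n) : ℝ := √(tensorInner W W)

/-- The mode-`k` unfolding: rows are indexed by the `k`th index, columns (the mode-`k` fibres) by
the tuple of all the other indices. -/
def unfolding (k : Fin K) (W : Tensor n) :
    Matrix (Fin (n k)) ((j : {j : Fin K // j ≠ k}) → Fin (n j)) ℝ :=
  Matrix.of fun a b => W ((Equiv.piSplitAt k fun j => Fin (n j)).symm (a, b))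

/-- The mode-`k` rank `r_k` of a tensor. -/
def modeRank (k : Fin K) (W : Tensor n) : ℕ := (unfolding k W).rank

/-- The trace norm of a real matrix: the sum of its singular values. -/
def traceNorm {p q : Type} [Fintype p] [Fintype q] [DecidableEq p] [DecidableEq q]
    (A : Matrix p q ℝ) : ℝ :=
  (Matrix.toEuclideanLin A).singularValues.sum fun _ s => s

/-- The scaled latent trace norm: the infimum of `∑ k, ‖V^{(k)}_{(k)}‖_tr / √(n_k)` over all
decompositions `∑ k, V^{(k)} = W`. -/
def scaledLatentTraceNorm (W : Tensor n) : ℝ :=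
  ⨅ V : {V : Fin K → Tensor n // ∑ k, V k = W},
    ∑ k, 1 / √(n k : ℝ) * traceNorm (unfolding k (V.1 k))

/-- The expected risk `R(W)` of the loss `l` under the distribution `μ` of `(X, y)`. -/
def risk {Y : Set ℝ} (l : ℝ → Y → ℝ) (μ : Measure (Tensor n × Y)) (W : Tensor n) : ℝ :=
  ∫ z, l (tensorInner W z.1) z.2 ∂μ

/-- The empirical risk of `W` on the training data set `S`. -/
def empiricalRisk {Y : Set ℝ} (l : ℝ → Y → ℝ) {m : ℕ} (S : Fin m → Tensor n × Y)
    (W : Tensor n) : ℝ :=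
  1 / (m : ℝ) * ∑ i, l (tensorInner W (S i).1) (S i).2

/-- `W` minimizes `F` subject to the constraint `‖W‖_scaled ≤ B₀`. -/
def IsConstrainedMinimizer (F : Tensor n → ℝ) (B₀ : ℝ) (W : Tensor n) : Prop :=
  scaledLatentTraceNorm W ≤ B₀ ∧ ∀ V : Tensor n, scaledLatentTraceNorm V ≤ B₀ → F W ≤ F V

/-- The entries of the covariate tensor are independent standard Gaussians. -/
def HasStandardGaussianCovariate {Y : Set ℝ} (μ : Measure (Tensor n × Y)) : Prop :=
  μ.map Prod.fst = Measure.pi fun _ => gaussianReal 0 1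

/-- `√(min_k (r_k / n_k))`, where `r_k` are the mode ranks of `W`. -/
def sqrtMinRelativeRank (W : Tensor n) : ℝ := √(⨅ k, (modeRank k W : ℝ) / (n k : ℝ))

/-- The right-hand side
`c₁ Λ B √((1/m) min_k (r_k/n_k)) (max_k (n_k + √N) + C √(2 log K)) + c₂ √(log (2/δ) / (2m))`,
where `r_k` are the mode ranks of `W₀` and `N = ∏ k, n_k`. -/
def excessRiskBound (c₁ c₂ C Λ B : ℝ) (W₀ : Tensor n) (m : ℕ) (δ : ℝ) : ℝ :=
  c₁ * Λ * B * √(1 / (m : ℝ) * ⨅ k, (modeRank k W₀ : ℝ) / (n k : ℝ)) *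
      ((⨆ k, ((n k : ℝ) + √(∏ j, (n j : ℝ)))) + C * √(2 * Real.log K)) +
    c₂ * √(Real.log (2 / δ) / (2 * m))

end TensorLearning

end

/-! The minimizer of the empirical risk has nonpositive empirical excess risk, so `m` times its
excess risk is at most the supremum, over the ball of radius `B₀`, of the deviation between expected
and empirical excess loss. It suffices to bound the upper tail of this supremum. Symmetrization with
a ghost sample and contraction, both at the level of exponential moments, replace the losses by `Λ⟨W
- W₀, X⟩`. The covariate is symmetric, so no Rademacher signs are needed
(`lintegral_pi_iSup_exp_le_of_contraction`). By duality the supremum is then controlled by the dual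
norm of the normalized sum of the covariates, again a standard Gaussian tensor. That norm is the
largest `√n_k` times the operator norm of a mode-`k` unfolding. Nets show it to be of order `√n_k
(√n_k + √(N / n_k)) = n_k + √N`, with variance proxy of order `max n_k`
(`lintegral_exp_dualBound_le`). For an arbitrary Lipschitz loss, Chernoff's bound applies directly
to this moment generating function. For a loss in `[0, 1]` it bounds only the mean of the supremum,
and McDiarmid's inequality gives the fluctuation. A maximum over modes would cost `log K`. Modes of
dimension one are all covered by the Frobenius norm, and there are at most `log₂ N` others, so this
cost is absorbed in `√N`; the `√(2 log K)` term is pure slack. Exponential moments are Lebesgue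
integrals in `ENNReal`, which avoids integrability conditions. Suprema are taken over finite
families and extended by continuity and separability. -/

namespace TensorLearning

/-! ### Duality for the scaled latent trace norm. -/

/-- Duality between the trace norm and the operator norm. -/
theorem sum_mul_le_traceNorm_mul {p q : Type} [Fintype p] [Fintype q] [DecidableEq p]
    [DecidableEq q] (A X : Matrix p q ℝ) {c : ℝ}
    (hX : ∀ v, ‖Matrix.toEuclideanLin X v‖ ≤ c * ‖v‖) :
    ∑ a, ∑ b, A a b * X a b ≤ traceNorm A * c := by
  set T := Matrix.toEuclideanLin A with hT
  set S := Matrix.toEuclideanLin X with hS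
  have hcol : ∀ (M : Matrix p q ℝ) (b : q) (a : p),
      Matrix.toEuclideanLin M (EuclideanSpace.basisFun q ℝ b) a = M a b := by
    intro M b a
    simp [Matrix.toLpLin_apply]
  have h1 : ∑ a, ∑ b, A a b * X a b = LinearMap.trace ℝ _ (LinearMap.adjoint T ∘ₗ S) := by
    rw [LinearMap.trace_eq_sum_inner _ (EuclideanSpace.basisFun q ℝ), Finset.sum_comm]
    refine Finset.sum_congr rfl fun b _ => ?_
    rw [LinearMap.comp_apply, LinearMap.adjoint_inner_right, PiLp.inner_apply]
    refine Finset.sum_congr rfl fun a _ => ?_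
    rw [hT, hS, hcol, hcol]
    simp [mul_comm]
  have hn : Module.finrank ℝ (EuclideanSpace ℝ q) = Fintype.card q := by simp
  -- These are right singular vectors of `A`, so `‖T (b i)‖` is the `i`th singular value. The trace
  -- in this basis is then bounded termwise by Cauchy–Schwarz.
  set b := T.isSymmetric_adjoint_comp_self.eigenvectorBasis hn with hb
  have hTb : ∀ i, ‖T (b i)‖ = T.singularValues i := by
    intro i
    rw [T.singularValues_fin hn i]
    symm
    rw [Real.sqrt_eq_iff_mul_self_eq (T.isPositive_adjoint_comp_self.nonneg_eigenvalues hn i)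
      (norm_nonneg _), ← real_inner_self_eq_norm_mul_norm, ← LinearMap.adjoint_inner_right,
      ← LinearMap.comp_apply, hb,
      LinearMap.IsSymmetric.apply_eigenvectorBasis, inner_smul_right,
      real_inner_self_eq_norm_mul_norm, OrthonormalBasis.norm_eq_one]
    simp
  -- `singularValues` is finitely supported on `ℕ` and vanishes from index `card q` on, so summing
  -- over the support or over `Fin (card q)` is the same.
  have hsum : traceNorm A = ∑ i : Fin (Fintype.card q), T.singularValues i := by
    rw [traceNorm, Finsupp.sum, ← hT,
      Fin.sum_univ_eq_sum_range (fun i => T.singularValues i) (Fintype.card q)]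
    refine Finset.sum_subset ?_ ?_
    · intro i hi
      rw [Finset.mem_range]
      by_contra hlt
      exact (Finsupp.mem_support_iff.1 hi)
        (T.singularValues_of_finrank_le (by rw [hn]; omega))
    · intro i _ hi
      exact Finsupp.notMem_support_iff.1 hi
  rw [h1, LinearMap.trace_eq_sum_inner _ b, hsum, Finset.sum_mul]
  refine Finset.sum_le_sum fun i _ => ?_
  rw [LinearMap.comp_apply, LinearMap.adjoint_inner_right]
  refine (real_inner_le_norm _ _).trans ?_
  rw [hTb]
  have := hX (b i)
  rw [OrthonormalBasis.norm_eq_one, mul_one] at this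
  exact mul_le_mul_of_nonneg_left this (T.singularValues_nonneg _)

theorem traceNorm_nonneg {p q : Type} [Fintype p] [Fintype q] [DecidableEq p]
    [DecidableEq q] (A : Matrix p q ℝ) : 0 ≤ traceNorm A :=
  Finset.sum_nonneg fun i _ => LinearMap.singularValues_nonneg _ i

variable {K : ℕ} {n : Fin K → ℕ}

theorem sum_unfolding_mul (k : Fin K) (W X : Tensor n) :
    ∑ a, ∑ b, unfolding k W a b * unfolding k X a b = tensorInner W X := by
  rw [← Fintype.sum_prod_type' (fun a b => unfolding k W a b * unfolding k X a b), tensorInner]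
  exact Equiv.sum_comp (Equiv.piSplitAt k fun j => Fin (n j)).symm (fun i => W i * X i)

/-- For each decomposition of `W`, duality is applied to the `k`th summand in its own mode. The
weight `1 / √n_k` of the trace norm is paid for by the factor `√n_k` on the operator norm. -/
theorem tensorInner_le_of_forall_mode {W X : Tensor n} (hK : 0 < K) (hn : ∀ k, 0 < n k) {M : ℝ}
    (hM : 0 ≤ M)
    (h : ∀ k v, √(n k : ℝ) * ‖Matrix.toEuclideanLin (unfolding k X) v‖ ≤ M * ‖v‖) :
    tensorInner W X ≤ scaledLatentTraceNorm W * M := by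
  have : Nonempty {V : Fin K → Tensor n // ∑ k, V k = W} :=
    ⟨⟨fun k => if k = ⟨0, hK⟩ then W else 0, by simp⟩⟩
  rw [scaledLatentTraceNorm, Real.iInf_mul_of_nonneg hM]
  refine le_ciInf fun V => ?_
  have hW : tensorInner W X = ∑ k, tensorInner (V.1 k) X := by
    conv_lhs => rw [← V.2]
    simp only [tensorInner, Finset.sum_apply, Finset.sum_mul]
    exact Finset.sum_comm
  rw [hW, Finset.sum_mul]
  refine Finset.sum_le_sum fun k _ => ?_
  have hk : 0 < √(n k : ℝ) := Real.sqrt_pos.2 (by exact_mod_cast hn k)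
  rw [← sum_unfolding_mul k]
  refine (sum_mul_le_traceNorm_mul _ _ (c := M / √(n k : ℝ)) fun v => ?_).trans (le_of_eq ?_)
  · rw [div_mul_eq_mul_div, le_div_iff₀ hk, mul_comm]
    exact h k v
  · field_simp

theorem tensorInner_self_nonneg (X : Tensor n) : 0 ≤ tensorInner X X :=
  Finset.sum_nonneg fun _ _ => mul_self_nonneg _

theorem frobeniusNorm_nonneg (X : Tensor n) : 0 ≤ frobeniusNorm X := Real.sqrt_nonneg _

theorem norm_toEuclideanLin_unfolding_le (k : Fin K) (X : Tensor n)
    (v : EuclideanSpace ℝ ((j : {j : Fin K // j ≠ k}) → Fin (n j))) :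
    ‖Matrix.toEuclideanLin (unfolding k X) v‖ ≤ frobeniusNorm X * ‖v‖ := by
  rw [EuclideanSpace.norm_eq, frobeniusNorm, EuclideanSpace.norm_eq,
    ← Real.sqrt_mul (tensorInner_self_nonneg X), ← sum_unfolding_mul k, Finset.sum_mul]
  refine Real.sqrt_le_sqrt (Finset.sum_le_sum fun a _ => ?_)
  have := Finset.sum_mul_sq_le_sq_mul_sq Finset.univ (fun b => unfolding k X a b) (fun b => v b)
  simpa [Matrix.toLpLin_apply, Matrix.mulVec, dotProduct, sq] using this

/-- The operator norm of the mode-`k` unfolding. -/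
noncomputable def modeOpNorm (k : Fin K) (X : Tensor n) : ℝ :=
  ‖LinearMap.toContinuousLinearMap (Matrix.toEuclideanLin (unfolding k X))‖

/-- The quantities whose maximum bounds the norm dual to the scaled latent trace norm: the Frobenius
norm takes care of all the modes of dimension one together. -/
noncomputable def modeDualBound (X : Tensor n) : Option {k : Fin K // 2 ≤ n k} → ℝ
  | none => frobeniusNorm X
  | some k => √(n k.1 : ℝ) * modeOpNorm k.1 X

/-- An upper bound of the norm dual to the scaled latent trace norm. -/
noncomputable def dualBound (X : Tensor n) : ℝ := ⨆ o, modeDualBound X o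

theorem modeDualBound_le_dualBound (X : Tensor n) (o : Option {k : Fin K // 2 ≤ n k}) :
    modeDualBound X o ≤ dualBound X :=
  le_ciSup (Set.finite_range _).bddAbove o

theorem dualBound_nonneg (X : Tensor n) : 0 ≤ dualBound X :=
  (frobeniusNorm_nonneg X).trans (modeDualBound_le_dualBound X none)

/-- If `n k = 1`, the weight is one and the operator norm is at most the Frobenius norm, so a single
entry `none` serves all such modes. -/
theorem tensorInner_le_mul_dualBound (hK : 0 < K) (hn : ∀ k, 0 < n k) (W X : Tensor n) :
    tensorInner W X ≤ scaledLatentTraceNorm W * dualBound X := by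
  refine tensorInner_le_of_forall_mode hK hn (dualBound_nonneg X) fun k v => ?_
  by_cases h1 : 2 ≤ n k
  · refine le_trans ?_ (mul_le_mul_of_nonneg_right
      (modeDualBound_le_dualBound X (some ⟨k, h1⟩)) (norm_nonneg v))
    rw [modeDualBound, mul_assoc]
    exact mul_le_mul_of_nonneg_left
      ((LinearMap.toContinuousLinearMap (Matrix.toEuclideanLin (unfolding k X))).le_opNorm v)
      (Real.sqrt_nonneg _)
  · have : n k = 1 := by have := hn k; omega
    refine le_trans ?_ (mul_le_mul_of_nonneg_right
      (modeDualBound_le_dualBound X none) (norm_nonneg v))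
    have hs : √(n k : ℝ) = 1 := by simp [this]
    rw [hs, one_mul]
    exact norm_toEuclideanLin_unfolding_le k X v

end TensorLearning

/-! ### Nets, and exponential moments of maxima. -/

namespace TensorLearning

section Net

/-- The unit ball of a `d`-dimensional space has a `1/2`-net of at most `5 ^ d` points. -/
theorem exists_half_net (E : Type*) [NormedAddCommGroup E] [NormedSpace ℝ E]
    [FiniteDimensional ℝ E] :
    ∃ s : Finset E, s.card ≤ 5 ^ Module.finrank ℝ E ∧ (∀ c ∈ s, ‖c‖ ≤ 1) ∧
      ∀ x : E, ‖x‖ ≤ 1 → ∃ c ∈ s, ‖x - c‖ ≤ 1 / 2 := by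
  classical
  -- A maximal `1`-separated subset of the ball of radius `2`, shrunk by one half, is the net. The
  -- volume bound for separated sets gives `5 ^ d`.
  let P : Finset E → Prop := fun s =>
    (∀ c ∈ s, ‖c‖ ≤ 2) ∧ ∀ c ∈ s, ∀ d ∈ s, c ≠ d → 1 ≤ ‖c - d‖
  have hcard : ∀ s, P s → s.card ≤ 5 ^ Module.finrank ℝ E :=
    fun s hs => Besicovitch.card_le_of_separated s hs.1 hs.2
  obtain ⟨k, ⟨s, hs, rfl⟩, hmax⟩ : ∃ k, (∃ s, P s ∧ s.card = k) ∧
      ∀ t, P t → t.card ≤ k := by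
    have hex : ∃ k, ∃ s, P s ∧ s.card = k := ⟨0, ∅, ⟨by simp, by simp⟩, rfl⟩
    refine ⟨Nat.findGreatest (fun k => ∃ s, P s ∧ s.card = k) (5 ^ Module.finrank ℝ E), ?_, ?_⟩
    · exact Nat.findGreatest_spec (P := fun k => ∃ s, P s ∧ s.card = k) (Nat.zero_le _)
        ⟨∅, ⟨by simp, by simp⟩, rfl⟩
    · intro t ht
      exact Nat.le_findGreatest (P := fun k => ∃ s, P s ∧ s.card = k) (hcard t ht) ⟨t, ht, rfl⟩
  refine ⟨s.image fun c => (1 / 2 : ℝ) • c, Finset.card_image_le.trans (hcard s hs), ?_, ?_⟩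
  · intro c hc
    obtain ⟨c', hc', rfl⟩ := Finset.mem_image.1 hc
    rw [norm_smul]
    have := hs.1 c' hc'
    norm_num
    linarith
  · intro x hx
    by_contra! hcon
    have hfar : ∀ c ∈ s, 1 ≤ ‖(2 : ℝ) • x - c‖ := by
      intro c hc
      have h := hcon _ (Finset.mem_image_of_mem _ hc)
      have he : x - (1 / 2 : ℝ) • c = (1 / 2 : ℝ) • ((2 : ℝ) • x - c) := by
        rw [smul_sub, smul_smul]; norm_num
      rw [he, norm_smul] at h
      norm_num at h
      linarith
    have hx2 : (2 : ℝ) • x ∉ s := fun h => by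
      have := hfar _ h
      simp at this
      linarith
    have := hmax (insert ((2 : ℝ) • x) s) ⟨?_, ?_⟩
    · rw [Finset.card_insert_of_notMem hx2] at this
      omega
    · intro c hc
      rcases Finset.mem_insert.1 hc with rfl | hc
      · rw [norm_smul]; norm_num; linarith
      · exact hs.1 c hc
    · intro c hc d hd hcd
      rcases Finset.mem_insert.1 hc with rfl | hc <;> rcases Finset.mem_insert.1 hd with rfl | hd
      · exact absurd rfl hcd
      · exact hfar d hd
      · rw [norm_sub_rev]; exact hfar c hc
      · exact hs.2 c hc d hd hcd

/-- A finite set of functionals which computes the norm up to a factor of two. -/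
theorem exists_norming_finset (E : Type*) [NormedAddCommGroup E] [InnerProductSpace ℝ E]
    [FiniteDimensional ℝ E] :
    ∃ s : Finset E, s.card ≤ 5 ^ Module.finrank ℝ E ∧ (∀ c ∈ s, ‖c‖ ≤ 1) ∧
      ∀ x : E, ∃ c ∈ s, ‖x‖ ≤ 2 * inner ℝ c x := by
  obtain ⟨s, hs, h1, hnet⟩ := exists_half_net E
  refine ⟨s, hs, h1, fun x => ?_⟩
  rcases eq_or_ne x 0 with rfl | hx
  · obtain ⟨c, hc, -⟩ := hnet 0 (by simp)
    exact ⟨c, hc, by simp⟩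
  · have hx' : 0 < ‖x‖ := norm_pos_iff.2 hx
    obtain ⟨c, hc, hd⟩ := hnet (‖x‖⁻¹ • x) (by rw [norm_smul]; simp [hx'.ne'])
    refine ⟨c, hc, ?_⟩
    have h2 : inner ℝ (‖x‖⁻¹ • x) x = ‖x‖ := by
      rw [real_inner_smul_left, real_inner_self_eq_norm_mul_norm]
      field_simp
    have h3 := real_inner_le_norm (‖x‖⁻¹ • x - c) x
    rw [inner_sub_left, h2] at h3
    nlinarith

/-- A finite set of vectors which computes operator norms up to a factor of two. -/
theorem exists_opNorm_finset (E F : Type*) [NormedAddCommGroup E] [NormedSpace ℝ E]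
    [FiniteDimensional ℝ E] [NormedAddCommGroup F] [NormedSpace ℝ F] :
    ∃ s : Finset E, s.card ≤ 5 ^ Module.finrank ℝ E ∧ (∀ c ∈ s, ‖c‖ ≤ 1) ∧
      ∀ T : E →L[ℝ] F, ∃ c ∈ s, ‖T‖ ≤ 2 * ‖T c‖ := by
  obtain ⟨s, hs, h1, hnet⟩ := exists_half_net E
  refine ⟨s, hs, h1, fun T => ?_⟩
  obtain ⟨c₀, hc₀, -⟩ := hnet 0 (by simp)
  obtain ⟨c, hc, hmax⟩ := s.exists_max_image (fun c => ‖T c‖) ⟨c₀, hc₀⟩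
  refine ⟨c, hc, ?_⟩
  -- A unit vector is within `1/2` of a net point; the error term is absorbed into the left-hand
  -- side.
  have : ‖T‖ ≤ ‖T c‖ + ‖T‖ / 2 := by
    refine T.opNorm_le_of_unit_norm (by positivity) fun x hx => ?_
    obtain ⟨d, hd, hxd⟩ := hnet x hx.le
    have h3 : T x = T d + T (x - d) := by simp
    rw [h3]
    refine (norm_add_le _ _).trans (add_le_add (hmax d hd) ?_)
    refine (T.le_opNorm _).trans ?_
    nlinarith [norm_nonneg T]
  linarith

end Net

section Exponential

variable {Ω : Type*} [MeasurableSpace Ω] {P : Measure Ω}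

/-- Removes a constant factor from a bound of the moment generating function, by interpolation with
a larger parameter. -/
theorem lintegral_exp_le_of_forall_le [IsProbabilityMeasure P] {Z : Ω → ℝ} {d a v : ℝ}
    (hd : 0 ≤ d) (hv : 0 < v)
    (h : ∀ s, 0 ≤ s → ∫⁻ ω, ENNReal.ofReal (Real.exp (s * Z ω)) ∂P ≤
      ENNReal.ofReal (Real.exp (d + a * s + v * s ^ 2))) {s : ℝ} (hs : 0 ≤ s) :
    ∫⁻ ω, ENNReal.ofReal (Real.exp (s * Z ω)) ∂P ≤
      ENNReal.ofReal (Real.exp ((a + 2 * √(v * d)) * s + 2 * v * s ^ 2)) := by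
  rcases hs.eq_or_lt with rfl | hs0
  · simp
  -- With this shift `d ≤ v * t ^ 2`. Interpolating between `0` and `t` with weight `θ = s / t`
  -- shrinks the constant to `θ * d ≤ v * s * t`, which vanishes linearly at `s = 0`.
  set t := s + √(d / v) with ht
  have hst : s ≤ t := by rw [ht]; linarith [Real.sqrt_nonneg (d / v)]
  have ht0 : 0 < t := hs0.trans_le hst
  set θ := s / t with hθ
  have hθ0 : 0 ≤ θ := by positivity
  have hθ1 : θ ≤ 1 := (div_le_one ht0).2 hst
  have hθt : θ * t = s := by rw [hθ]; field_simp
  set b := d + a * t + v * t ^ 2 with hb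
  have hone : ∫⁻ ω, ENNReal.ofReal (Real.exp (t * Z ω - b)) ∂P ≤ 1 := by
    have : ∀ ω, ENNReal.ofReal (Real.exp (t * Z ω - b)) =
        ENNReal.ofReal (Real.exp (-b)) * ENNReal.ofReal (Real.exp (t * Z ω)) := by
      intro ω
      rw [← ENNReal.ofReal_mul (Real.exp_nonneg _), ← Real.exp_add]
      ring_nf
    simp_rw [this]
    rw [lintegral_const_mul' _ _ ENNReal.ofReal_ne_top]
    refine (mul_le_mul_right (h t ht0.le) _).trans ?_
    rw [← ENNReal.ofReal_mul (Real.exp_nonneg _), ← Real.exp_add, ← hb]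
    simp
  -- Convexity of `exp` between `0` and `t * Z ω - b` plays the role of Hölder's inequality.
  have hpt : ∀ ω, ENNReal.ofReal (Real.exp (s * Z ω)) ≤ ENNReal.ofReal (Real.exp (θ * b)) *
      (ENNReal.ofReal (1 - θ) + ENNReal.ofReal θ * ENNReal.ofReal (Real.exp (t * Z ω - b))) := by
    intro ω
    rw [← ENNReal.ofReal_mul hθ0, ← ENNReal.ofReal_add (by linarith) (by positivity),
      ← ENNReal.ofReal_mul (Real.exp_nonneg _)]
    refine ENNReal.ofReal_le_ofReal ?_
    have hc := convexOn_exp.2 (Set.mem_univ 0) (Set.mem_univ (t * Z ω - b))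
      (by linarith : 0 ≤ 1 - θ) hθ0 (by ring)
    simp only [smul_eq_mul, mul_zero, zero_add, Real.exp_zero, mul_one] at hc
    have he : s * Z ω = θ * b + θ * (t * Z ω - b) := by rw [← hθt]; ring
    rw [he, Real.exp_add]
    exact mul_le_mul_of_nonneg_left hc (Real.exp_nonneg _)
  calc ∫⁻ ω, ENNReal.ofReal (Real.exp (s * Z ω)) ∂P
      ≤ _ := lintegral_mono hpt
    _ = ENNReal.ofReal (Real.exp (θ * b)) * (ENNReal.ofReal (1 - θ) + ENNReal.ofReal θ *
        ∫⁻ ω, ENNReal.ofReal (Real.exp (t * Z ω - b)) ∂P) := by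
      rw [lintegral_const_mul' _ _ ENNReal.ofReal_ne_top, lintegral_add_left measurable_const,
        lintegral_const_mul' _ _ ENNReal.ofReal_ne_top]
      simp
    _ ≤ ENNReal.ofReal (Real.exp (θ * b)) * (ENNReal.ofReal (1 - θ) + ENNReal.ofReal θ * 1) := by
      gcongr
    _ = ENNReal.ofReal (Real.exp (θ * b)) := by
      rw [mul_one, ← ENNReal.ofReal_add (by linarith) hθ0]
      simp
    _ ≤ _ := by
      refine ENNReal.ofReal_le_ofReal (Real.exp_le_exp.2 ?_)
      have h1 : d ≤ v * t ^ 2 := by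
        have : √(d / v) ^ 2 ≤ t ^ 2 := by
          refine pow_le_pow_left₀ (Real.sqrt_nonneg _) ?_ 2
          rw [ht]; linarith
        rw [Real.sq_sqrt (by positivity), div_le_iff₀ hv] at this
        linarith
      have h2 : θ * b ≤ a * s + 2 * v * s * t := by
        have : θ * b = θ * d + a * (θ * t) + v * (θ * t) * t := by rw [hb]; ring
        rw [this, hθt]
        have : θ * d ≤ v * (θ * t) * t := by nlinarith
        rw [hθt] at this
        linarith
      have h3 : v * √(d / v) = √(v * d) := by
        rw [show v * d = v ^ 2 * (d / v) by field_simp, Real.sqrt_mul (by positivity),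
          Real.sqrt_sq hv.le]
      have h4 : v * s * t = v * s ^ 2 + s * √(v * d) := by rw [ht, ← h3]; ring
      nlinarith

/-- Union bound for the moment generating function of a maximum. -/
theorem lintegral_exp_le_of_exists_le {ι : Type*} (T : Finset ι) {Z : Ω → ℝ} {Zi : ι → Ω → ℝ}
    (hm : ∀ i ∈ T, Measurable (Zi i)) (hZ : ∀ ω, ∃ i ∈ T, Z ω ≤ Zi i ω) {s d b : ℝ} (hs : 0 ≤ s)
    (hT : (T.card : ℝ) ≤ Real.exp d)
    (h : ∀ i ∈ T, ∫⁻ ω, ENNReal.ofReal (Real.exp (s * Zi i ω)) ∂P ≤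
      ENNReal.ofReal (Real.exp b)) :
    ∫⁻ ω, ENNReal.ofReal (Real.exp (s * Z ω)) ∂P ≤ ENNReal.ofReal (Real.exp (d + b)) := by
  calc ∫⁻ ω, ENNReal.ofReal (Real.exp (s * Z ω)) ∂P
      ≤ ∫⁻ ω, ∑ i ∈ T, ENNReal.ofReal (Real.exp (s * Zi i ω)) ∂P := by
        refine lintegral_mono fun ω => ?_
        obtain ⟨i, hi, hle⟩ := hZ ω
        refine le_trans (ENNReal.ofReal_le_ofReal (Real.exp_le_exp.2
          (mul_le_mul_of_nonneg_left hle hs))) ?_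
        exact Finset.single_le_sum (f := fun i => ENNReal.ofReal (Real.exp (s * Zi i ω)))
          (fun _ _ => zero_le) hi
    _ = ∑ i ∈ T, ∫⁻ ω, ENNReal.ofReal (Real.exp (s * Zi i ω)) ∂P :=
        lintegral_finsetSum' _ fun i hi =>
          ((hm i hi).const_mul s).exp.ennreal_ofReal.aemeasurable
    _ ≤ ∑ i ∈ T, ENNReal.ofReal (Real.exp b) := Finset.sum_le_sum h
    _ = ENNReal.ofReal (T.card * Real.exp b) := by
        rw [Finset.sum_const, nsmul_eq_mul, ENNReal.ofReal_mul (by positivity),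
          ENNReal.ofReal_natCast]
    _ ≤ _ := by
        rw [Real.exp_add]
        exact ENNReal.ofReal_le_ofReal (mul_le_mul_of_nonneg_right hT (Real.exp_nonneg _))

theorem five_pow_le_exp (k : ℕ) : (5 : ℝ) ^ k ≤ Real.exp (2 * k) := by
  rw [mul_comm, Real.exp_nat_mul]
  refine pow_le_pow_left₀ (by norm_num) ?_ k
  have h := Real.exp_one_gt_d9
  rw [show (2 : ℝ) = 1 + 1 by norm_num, Real.exp_add]
  nlinarith

end Exponential

end TensorLearning

/-! ### The dual norm of a sub-Gaussian tensor. -/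

namespace TensorLearning

variable {K : ℕ} {n : Fin K → ℕ}

theorem tensorInner_smul_left (c : ℝ) (W X : Tensor n) :
    tensorInner (c • W) X = c * tensorInner W X := by
  simp [tensorInner, Finset.mul_sum, mul_assoc]

theorem tensorInner_smul_right (c : ℝ) (W X : Tensor n) :
    tensorInner W (c • X) = c * tensorInner W X := by
  simp [tensorInner, Finset.mul_sum, mul_left_comm]

theorem tensorInner_sub_left (W V X : Tensor n) :
    tensorInner (W - V) X = tensorInner W X - tensorInner V X := by
  simp [tensorInner, sub_mul]

theorem measurable_tensorInner (W : Tensor n) : Measurable (tensorInner W) := by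
  unfold tensorInner
  fun_prop

/-- The rank-one tensor whose mode-`k` unfolding is `u vᵀ`. -/
noncomputable def rankOneTensor (k : Fin K) (u : Fin (n k) → ℝ)
    (v : ((j : {j : Fin K // j ≠ k}) → Fin (n j)) → ℝ) : Tensor n :=
  fun i => u (i k) * v fun j => i j

theorem unfolding_rankOneTensor (k : Fin K) (u : Fin (n k) → ℝ)
    (v : ((j : {j : Fin K // j ≠ k}) → Fin (n j)) → ℝ) (a) (b) :
    unfolding k (rankOneTensor k u v) a b = u a * v b := by
  have h1 : (Equiv.piSplitAt k fun j => Fin (n j)) ((Equiv.piSplitAt k fun j => Fin (n j)).symm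
      (a, b)) = (a, b) := Equiv.apply_symm_apply _ _
  have h2 := congrArg Prod.fst h1
  have h3 := congrArg Prod.snd h1
  simp only [Equiv.piSplitAt_apply] at h2 h3
  simp only [unfolding, rankOneTensor, Matrix.of_apply]
  rw [h2, h3]

/-- The bilinear form of an unfolding becomes a linear functional of the tensor, so the sub-Gaussian
hypothesis applies to it. -/
theorem tensorInner_rankOneTensor (k : Fin K) (u : EuclideanSpace ℝ (Fin (n k)))
    (v : EuclideanSpace ℝ ((j : {j : Fin K // j ≠ k}) → Fin (n j))) (X : Tensor n) :
    tensorInner (rankOneTensor k u v) X =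
      inner ℝ u (Matrix.toEuclideanLin (unfolding k X) v) := by
  rw [← sum_unfolding_mul k, PiLp.inner_apply]
  refine Finset.sum_congr rfl fun a _ => ?_
  simp only [unfolding_rankOneTensor, Matrix.toLpLin_apply, Matrix.mulVec, dotProduct]
  simp only [RCLike.inner_apply, conj_trivial, Finset.sum_mul]
  exact Finset.sum_congr rfl fun b _ => by ring

theorem tensorInner_rankOneTensor_self (k : Fin K) (u : EuclideanSpace ℝ (Fin (n k)))
    (v : EuclideanSpace ℝ ((j : {j : Fin K // j ≠ k}) → Fin (n j))) :
    tensorInner (rankOneTensor k u v) (rankOneTensor k u v) = ‖u‖ ^ 2 * ‖v‖ ^ 2 := by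
  rw [← sum_unfolding_mul k, EuclideanSpace.real_norm_sq_eq, EuclideanSpace.real_norm_sq_eq,
    Finset.sum_mul_sum]
  simp only [unfolding_rankOneTensor]
  exact Finset.sum_congr rfl fun a _ => Finset.sum_congr rfl fun b _ => by ring

section Exponential

variable {Ω : Type*} [MeasurableSpace Ω] {P : Measure Ω} {Y : Ω → Tensor n}

theorem lintegral_exp_mul_tensorInner_le
    (h : ∀ W, ∫⁻ ω, ENNReal.ofReal (Real.exp (tensorInner W (Y ω))) ∂P ≤
      ENNReal.ofReal (Real.exp (tensorInner W W / 2))) (s c b : ℝ) (W : Tensor n)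
    (hW : tensorInner W W ≤ b) :
    ∫⁻ ω, ENNReal.ofReal (Real.exp (s * (c * tensorInner W (Y ω)))) ∂P ≤
      ENNReal.ofReal (Real.exp (c ^ 2 * b / 2 * s ^ 2)) := by
  have := h ((s * c) • W)
  simp only [tensorInner_smul_left, tensorInner_smul_right, mul_assoc] at this ⊢
  refine this.trans (ENNReal.ofReal_le_ofReal (Real.exp_le_exp.2 ?_))
  have : 0 ≤ (s * c) ^ 2 := sq_nonneg _
  nlinarith

/-- The norm is at most twice the maximum of `5 ^ N` functionals of variance at most one. The
entropy `2 * N` enters only through its square root. -/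
theorem lintegral_exp_frobeniusNorm_le [IsProbabilityMeasure P] (hY : Measurable Y)
    (h : ∀ W, ∫⁻ ω, ENNReal.ofReal (Real.exp (tensorInner W (Y ω))) ∂P ≤
      ENNReal.ofReal (Real.exp (tensorInner W W / 2))) {s : ℝ} (hs : 0 ≤ s) :
    ∫⁻ ω, ENNReal.ofReal (Real.exp (s * frobeniusNorm (Y ω))) ∂P ≤
      ENNReal.ofReal (Real.exp (4 * √(∏ j, (n j : ℝ)) * s + 4 * s ^ 2)) := by
  obtain ⟨T, hT, hT1, hnorm⟩ := exists_norming_finset (EuclideanSpace ℝ ((k : Fin K) → Fin (n k)))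
  have hcard : (T.card : ℝ) ≤ Real.exp (2 * ∏ j, (n j : ℝ)) := by
    have hd : Module.finrank ℝ (EuclideanSpace ℝ ((k : Fin K) → Fin (n k))) = ∏ j, n j := by
      simp
    rw [hd] at hT
    refine le_trans (by exact_mod_cast hT) ((five_pow_le_exp (∏ j, n j)).trans (le_of_eq ?_))
    push_cast
    rfl
  have hfrob : ∀ ω, ∃ c ∈ T, frobeniusNorm (Y ω) ≤ 2 * tensorInner c (Y ω) := by
    intro ω
    obtain ⟨c, hc, hle⟩ := hnorm (WithLp.toLp 2 (Y ω))
    refine ⟨c, hc, le_trans (le_of_eq ?_) (hle.trans (le_of_eq ?_))⟩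
    · rw [EuclideanSpace.norm_eq, frobeniusNorm, tensorInner]
      simp [sq]
    · rw [PiLp.inner_apply, tensorInner]
      simp [mul_comm]
  have hmain := lintegral_exp_le_of_forall_le (P := P) (Z := fun ω => frobeniusNorm (Y ω))
    (d := 2 * ∏ j, (n j : ℝ)) (a := 0) (v := 2) (by positivity) (by norm_num) (fun s hs => by
      have := lintegral_exp_le_of_exists_le (P := P) T (Z := fun ω => frobeniusNorm (Y ω))
        (Zi := fun c ω => 2 * tensorInner c (Y ω)) (s := s) (b := 2 * s ^ 2)
        (fun c _ => ((measurable_tensorInner _).comp hY).const_mul 2) hfrob hs hcard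
        (fun c hc => by
          have h1 : tensorInner (c : (k : (k : Fin K) → Fin (n k)) → ℝ) c ≤ 1 := by
            have := hT1 c hc
            have h2 : tensorInner (c : (k : (k : Fin K) → Fin (n k)) → ℝ) c = ‖c‖ ^ 2 := by
              rw [EuclideanSpace.real_norm_sq_eq, tensorInner]
              exact Finset.sum_congr rfl fun _ _ => by ring
            rw [h2]
            nlinarith [norm_nonneg c]
          refine (lintegral_exp_mul_tensorInner_le h s 2 1 _ h1).trans (le_of_eq ?_)
          norm_num)
      simpa using this) hs
  refine hmain.trans (ENNReal.ofReal_le_ofReal (Real.exp_le_exp.2 (le_of_eq ?_)))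
  rw [← mul_assoc, Real.sqrt_mul (by norm_num), show (2 : ℝ) * 2 = 2 ^ 2 by norm_num,
    Real.sqrt_sq (by norm_num)]
  ring

/-- Nets on both sides give at most `5 ^ (n_k + q)` rank-one functionals with `q = N / n_k`, at the
cost of a factor `4`. The scaling by `√n_k` turns the square root of the entropy into `√(n_k² + N)`.
-/
theorem lintegral_exp_modeOpNorm_le [IsProbabilityMeasure P] (hY : Measurable Y)
    (hn : ∀ k, 0 < n k)
    (h : ∀ W, ∫⁻ ω, ENNReal.ofReal (Real.exp (tensorInner W (Y ω))) ∂P ≤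
      ENNReal.ofReal (Real.exp (tensorInner W W / 2))) (k : Fin K) {s : ℝ} (hs : 0 ≤ s) :
    ∫⁻ ω, ENNReal.ofReal (Real.exp (s * (√(n k : ℝ) * modeOpNorm k (Y ω)))) ∂P ≤
      ENNReal.ofReal (Real.exp (8 * (n k + √(∏ j, (n j : ℝ))) * s + 16 * n k * s ^ 2)) := by
  set q := Fintype.card ((j : {j : Fin K // j ≠ k}) → Fin (n j)) with hq
  have hN : (n k : ℝ) * q = ∏ j, (n j : ℝ) := by
    have := Fintype.card_congr (Equiv.piSplitAt k fun j => Fin (n j))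
    rw [Fintype.card_prod, ← hq, Fintype.card_pi] at this
    simp only [Fintype.card_fin] at this
    exact_mod_cast this.symm
  have hk : (0 : ℝ) < n k := by exact_mod_cast hn k
  obtain ⟨U, hU, hU1, hUnorm⟩ := exists_norming_finset (EuclideanSpace ℝ (Fin (n k)))
  obtain ⟨V, hV, hV1, hVnorm⟩ := exists_opNorm_finset
    (EuclideanSpace ℝ ((j : {j : Fin K // j ≠ k}) → Fin (n j))) (EuclideanSpace ℝ (Fin (n k)))
  have hcard : ((U ×ˢ V).card : ℝ) ≤ Real.exp (2 * (n k + q)) := by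
    rw [finrank_euclideanSpace] at hU hV
    rw [Fintype.card_fin] at hU
    rw [Finset.card_product, Nat.cast_mul, mul_add, Real.exp_add]
    refine mul_le_mul ?_ ?_ (by positivity) (by positivity)
    · exact le_trans (by exact_mod_cast hU) (five_pow_le_exp _)
    · exact le_trans (by exact_mod_cast hV) (five_pow_le_exp _)
  have hop : ∀ ω, ∃ c ∈ U ×ˢ V, √(n k : ℝ) * modeOpNorm k (Y ω) ≤
      4 * √(n k : ℝ) * tensorInner (rankOneTensor k c.1 c.2) (Y ω) := by
    intro ω
    obtain ⟨v, hv, hle⟩ := hVnorm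
      (LinearMap.toContinuousLinearMap (Matrix.toEuclideanLin (unfolding k (Y ω))))
    obtain ⟨u, hu, hle'⟩ := hUnorm (Matrix.toEuclideanLin (unfolding k (Y ω)) v)
    refine ⟨(u, v), Finset.mk_mem_product hu hv, ?_⟩
    rw [tensorInner_rankOneTensor, mul_comm 4, mul_assoc]
    refine mul_le_mul_of_nonneg_left ?_ (Real.sqrt_nonneg _)
    rw [modeOpNorm]
    refine hle.trans ?_
    rw [LinearMap.coe_toContinuousLinearMap']
    linarith
  have hmain := lintegral_exp_le_of_forall_le (P := P)
    (Z := fun ω => √(n k : ℝ) * modeOpNorm k (Y ω))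
    (d := 2 * (n k + q)) (a := 0) (v := 8 * n k) (by positivity) (by positivity) (fun s hs => by
      have := lintegral_exp_le_of_exists_le (P := P) (U ×ˢ V)
        (Z := fun ω => √(n k : ℝ) * modeOpNorm k (Y ω))
        (Zi := fun c ω => 4 * √(n k : ℝ) * tensorInner (rankOneTensor k c.1 c.2) (Y ω))
        (s := s) (b := 8 * n k * s ^ 2)
        (fun c _ => ((measurable_tensorInner _).comp hY).const_mul _) hop hs hcard
        (fun c hc => by
          have h1 : tensorInner (rankOneTensor k c.1 c.2) (rankOneTensor k c.1 c.2) ≤ 1 := by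
            rw [Finset.mem_product] at hc
            rw [tensorInner_rankOneTensor_self]
            exact mul_le_one₀ (pow_le_one₀ (norm_nonneg _) (hU1 _ hc.1)) (by positivity)
              (pow_le_one₀ (norm_nonneg _) (hV1 _ hc.2))
          refine (lintegral_exp_mul_tensorInner_le h s (4 * √(n k : ℝ)) 1 _ h1).trans
            (le_of_eq ?_)
          rw [mul_pow, Real.sq_sqrt hk.le]
          ring_nf)
      simpa using this) hs
  refine hmain.trans (ENNReal.ofReal_le_ofReal (Real.exp_le_exp.2 ?_))
  have h1 : √(8 * n k * (2 * (n k + q))) ≤ 4 * (n k + √(∏ j, (n j : ℝ))) := by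
    rw [Real.sqrt_le_left (by positivity)]
    have h2 : √(∏ j, (n j : ℝ)) ^ 2 = n k * q := by
      rw [← hN, Real.sq_sqrt (by positivity)]
    have h3 : 0 ≤ n k * √(∏ j, (n j : ℝ)) := by positivity
    nlinarith
  nlinarith

/-- Each mode of dimension at least two doubles `N`, so the cardinality is at most `N`, and `N ≤ (1
+ √N) ^ 2 ≤ exp (2 * √N)`. The maximum over modes thus costs entropy `2 * √N`, with no dependence on
`K`. -/
theorem card_option_modes_le (hn : ∀ k, 0 < n k) :
    (Fintype.card (Option {k : Fin K // 2 ≤ n k}) : ℝ) ≤ Real.exp (2 * √(∏ j, (n j : ℝ))) := by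
  have h1 : Fintype.card (Option {k : Fin K // 2 ≤ n k}) ≤ ∏ j, n j := by
    rw [Fintype.card_option, Fintype.card_subtype]
    calc _ ≤ 2 ^ (Finset.univ.filter fun k => 2 ≤ n k).card := Nat.lt_two_pow_self
      _ = ∏ k ∈ Finset.univ.filter (fun k => 2 ≤ n k), 2 := by simp
      _ ≤ ∏ k ∈ Finset.univ.filter (fun k => 2 ≤ n k), n k :=
        Finset.prod_le_prod' fun k hk => (Finset.mem_filter.1 hk).2
      _ ≤ ∏ j, n j := Finset.prod_le_prod_of_subset_of_one_le' (Finset.filter_subset _ _)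
        fun k _ _ => hn k
  have h2 : (Fintype.card (Option {k : Fin K // 2 ≤ n k}) : ℝ) ≤ ∏ j, (n j : ℝ) := by
    exact_mod_cast h1
  refine h2.trans ?_
  have h3 : ∏ j, (n j : ℝ) = √(∏ j, (n j : ℝ)) ^ 2 := (Real.sq_sqrt (by positivity)).symm
  have h4 := Real.add_one_le_exp √(∏ j, (n j : ℝ))
  conv_lhs => rw [h3]
  rw [mul_comm, Real.exp_mul]
  rw [Real.rpow_two]
  exact pow_le_pow_left₀ (Real.sqrt_nonneg _) (by linarith) 2

theorem measurable_modeDualBound (o : Option {k : Fin K // 2 ≤ n k}) :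
    Measurable fun X : Tensor n => modeDualBound X o := by
  rcases o with _ | k
  · simp only [modeDualBound, frobeniusNorm, tensorInner]
    fun_prop
  · simp only [modeDualBound, modeOpNorm]
    refine Measurable.const_mul ?_ _
    -- The unfolding is linear on a finite-dimensional space, hence continuous, and so is its
    -- operator norm.
    let Φ : Tensor n →ₗ[ℝ] (EuclideanSpace ℝ ((j : {j : Fin K // j ≠ k.1}) → Fin (n j)) →L[ℝ]
        EuclideanSpace ℝ (Fin (n k.1))) :=
      { toFun := fun X => LinearMap.toContinuousLinearMap (Matrix.toEuclideanLin (unfolding k.1 X))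
        map_add' := fun X Y => by
          rw [← map_add, ← map_add]; rfl
        map_smul' := fun c X => by
          rw [RingHom.id_apply, ← map_smul, ← map_smul]; rfl }
    exact (LinearMap.continuous_of_finiteDimensional Φ).norm.measurable

/-- The moment generating function of the dual norm of a standard (sub-)Gaussian tensor. -/
theorem lintegral_exp_dualBound_le [IsProbabilityMeasure P] (hY : Measurable Y)
    (hn : ∀ k, 0 < n k)
    (h : ∀ W, ∫⁻ ω, ENNReal.ofReal (Real.exp (tensorInner W (Y ω))) ∂P ≤
      ENNReal.ofReal (Real.exp (tensorInner W W / 2))) {L ν : ℝ} (hν : 1 ≤ ν)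
    (hnν : ∀ k, (n k : ℝ) ≤ ν) (hL : ν + √(∏ j, (n j : ℝ)) ≤ L) {s : ℝ} (hs : 0 ≤ s) :
    ∫⁻ ω, ENNReal.ofReal (Real.exp (s * dualBound (Y ω))) ∂P ≤
      ENNReal.ofReal (Real.exp (16 * L * s + 32 * ν * s ^ 2)) := by
  set N := √(∏ j, (n j : ℝ)) with hN
  have hN0 : 0 ≤ N := Real.sqrt_nonneg _
  have hmain := lintegral_exp_le_of_forall_le (P := P)
    (Z := fun ω => dualBound (Y ω))
    (d := 2 * N) (a := 8 * L) (v := 16 * ν) (by positivity) (by positivity) (fun s hs => by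
      have := lintegral_exp_le_of_exists_le (P := P) Finset.univ
        (Z := fun ω => dualBound (Y ω))
        (Zi := fun o ω => modeDualBound (Y ω) o)
        (s := s) (b := 8 * L * s + 16 * ν * s ^ 2)
        (fun o _ => (measurable_modeDualBound o).comp hY)
        (fun ω => by
          obtain ⟨o, ho⟩ := exists_eq_ciSup_of_finite (f := fun o => modeDualBound (Y ω) o)
          exact ⟨o, Finset.mem_univ _, ho.symm.le⟩) hs (card_option_modes_le hn)
        (fun o _ => by
          rcases o with _ | k
          · refine (lintegral_exp_frobeniusNorm_le hY h hs).trans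
              (ENNReal.ofReal_le_ofReal (Real.exp_le_exp.2 ?_))
            have : 4 * N ≤ 8 * L := by linarith
            have h2 := mul_le_mul_of_nonneg_right this hs
            nlinarith [sq_nonneg s]
          · refine (lintegral_exp_modeOpNorm_le hY hn h k.1 hs).trans
              (ENNReal.ofReal_le_ofReal (Real.exp_le_exp.2 ?_))
            have : 8 * (n k.1 + N) ≤ 8 * L := by linarith [hnν k.1]
            have h2 := mul_le_mul_of_nonneg_right this hs
            have h3 := mul_le_mul_of_nonneg_right (hnν k.1) (sq_nonneg s)
            nlinarith)
      rw [add_assoc]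
      exact this) hs
  refine hmain.trans (ENNReal.ofReal_le_ofReal (Real.exp_le_exp.2 ?_))
  -- AM–GM: `4 * ν * N ≤ (ν + N) ^ 2 ≤ L ^ 2`, so the entropy of the modes is absorbed in `L`.
  have h1 : √(16 * ν * (2 * N)) ≤ 4 * L := by
    rw [Real.sqrt_le_left (by linarith)]
    nlinarith [sq_nonneg (ν - N)]
  nlinarith

end Exponential

end TensorLearning

/-! ### Symmetrization, contraction and concentration. -/

namespace TensorLearning

/-- Weak majorization for an increasing convex function: the pair `(A, B)` has the larger sum and
the larger maximum. -/
theorem exp_add_exp_le_of_add_le {x y A B : ℝ} (hsum : x + y ≤ A + B) (hx : x ≤ max A B)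
    (hy : y ≤ max A B) : Real.exp x + Real.exp y ≤ Real.exp A + Real.exp B := by
  wlog hxy : y ≤ x generalizing x y
  · rw [add_comm]
    exact this (by linarith) hy hx (by linarith)
  wlog hAB : B ≤ A generalizing A B
  · rw [add_comm (Real.exp A)]
    exact this (by linarith) (max_comm A B ▸ hx) (max_comm A B ▸ hy) (by linarith)
  rw [max_eq_left hAB] at hx hy
  rcases le_total x B with hxB | hBx
  · exact add_le_add (Real.exp_le_exp.2 hx) (Real.exp_le_exp.2 (hxy.trans hxB))
  · have h1 : Real.exp y ≤ Real.exp A * Real.exp (B - x) := by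
      rw [← Real.exp_add]
      exact Real.exp_le_exp.2 (by linarith)
    have h2 : Real.exp (B - x) ≤ 1 := Real.exp_le_one_iff.2 (by linarith)
    have h3 : Real.exp x ≤ Real.exp A := Real.exp_le_exp.2 hx
    have h4 : Real.exp B = Real.exp x * Real.exp (B - x) := by
      rw [← Real.exp_add]; ring_nf
    nlinarith

variable {J : Type*} [Finite J] [Nonempty J]

/-- The contraction principle for one Rademacher variable and the exponential function. -/
theorem iSup_exp_add_iSup_exp_sub_le (a φ t : J → ℝ)
    (h : ∀ j k, |φ j - φ k| ≤ |t j - t k|) (h0 : ∀ j, |φ j| ≤ |t j|) :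
    (⨆ j, ENNReal.ofReal (Real.exp (a j + φ j))) + (⨆ j, ENNReal.ofReal (Real.exp (a j - φ j))) ≤
    (⨆ j, ENNReal.ofReal (Real.exp (a j + t j))) +
      (⨆ j, ENNReal.ofReal (Real.exp (a j - t j))) := by
  obtain ⟨j, hj⟩ := exists_eq_ciSup_of_finite
    (f := fun j => ENNReal.ofReal (Real.exp (a j + φ j)))
  obtain ⟨k, hk⟩ := exists_eq_ciSup_of_finite
    (f := fun j => ENNReal.ofReal (Real.exp (a j - φ j)))
  -- The maximizers `p`, `q` on the right weakly majorize `j`, `k` on the left. The bound on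
  -- differences controls the sum, after exchanging `j` and `k` if `t j < t k`. The bound `h0`
  -- controls each exponent separately.
  obtain ⟨p, hp⟩ := Finite.exists_max fun j => a j + t j
  obtain ⟨q, hq⟩ := Finite.exists_max fun j => a j - t j
  rw [← hj, ← hk]
  refine le_trans ?_ (add_le_add
    (le_iSup (fun j => ENNReal.ofReal (Real.exp (a j + t j))) p)
    (le_iSup (fun j => ENNReal.ofReal (Real.exp (a j - t j))) q))
  rw [← ENNReal.ofReal_add (by positivity) (by positivity),
    ← ENNReal.ofReal_add (by positivity) (by positivity)]
  refine ENNReal.ofReal_le_ofReal (exp_add_exp_le_of_add_le ?_ ?_ ?_)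
  · have h1 := le_trans (le_abs_self _) (h j k)
    rcases abs_cases (t j - t k) with h2 | h2
    · linarith [hp j, hq k]
    · linarith [hp k, hq j]
  · have h1 := le_trans (le_abs_self _) (h0 j)
    rcases abs_cases (t j) with h2 | h2
    · exact le_max_of_le_left (by linarith [hp j])
    · exact le_max_of_le_right (by linarith [hq j])
  · have h1 := le_trans (neg_le_abs _) (h0 k)
    rcases abs_cases (t k) with h2 | h2
    · exact le_max_of_le_left (by linarith [hp k])
    · exact le_max_of_le_right (by linarith [hq k])

variable {Z : Type*} [MeasurableSpace Z] {μ : Measure Z} [IsProbabilityMeasure μ]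

/-- Jensen's inequality for the exponential function, without integrability of the exponential. -/
theorem ofReal_exp_integral_le {f : Z → ℝ} (hf : Integrable f μ) :
    ENNReal.ofReal (Real.exp (∫ z, f z ∂μ)) ≤ ∫⁻ z, ENNReal.ofReal (Real.exp (f z)) ∂μ := by
  set c := ∫ z, f z ∂μ with hc
  have h1 : ∀ z, Real.exp c * (1 + (f z - c)) ≤ Real.exp (f z) := by
    intro z
    have h := Real.add_one_le_exp (f z - c)
    calc Real.exp c * (1 + (f z - c)) ≤ Real.exp c * Real.exp (f z - c) :=
          mul_le_mul_of_nonneg_left (by linarith) (Real.exp_nonneg _)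
      _ = Real.exp (f z) := by rw [← Real.exp_add]; ring_nf
  have hint : Integrable (fun z => Real.exp c * (1 + (f z - c))) μ :=
    ((integrable_const 1).add (hf.sub (integrable_const c))).const_mul _
  have h2 : ∫ z, Real.exp c * (1 + (f z - c)) ∂μ = Real.exp c := by
    have hi : Integrable (fun z => f z - c) μ := hf.sub (integrable_const c)
    rw [integral_const_mul, integral_add (integrable_const _) hi,
      integral_sub hf (integrable_const _)]
    simp [← hc]
  calc ENNReal.ofReal (Real.exp c) = ENNReal.ofReal (∫ z, Real.exp c * (1 + (f z - c)) ∂μ) := by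
        rw [h2]
    _ ≤ ∫⁻ z, ENNReal.ofReal (Real.exp c * (1 + (f z - c))) ∂μ := by
        refine ENNReal.ofReal_le_of_le_toReal ?_
        have hfin : ∫⁻ z, ENNReal.ofReal (Real.exp c * (1 + (f z - c))) ∂μ ≠ ⊤ :=
          (hint.lintegral_lt_top).ne
        rw [integral_eq_lintegral_pos_part_sub_lintegral_neg_part hint]
        linarith [ENNReal.toReal_nonneg
          (a := ∫⁻ z, ENNReal.ofReal (-(Real.exp c * (1 + (f z - c)))) ∂μ)]
    _ ≤ _ := lintegral_mono fun z => ENNReal.ofReal_le_ofReal (h1 z)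

/-- Symmetrization and contraction for a single sample. -/
theorem lintegral_iSup_exp_le_of_contraction {h t : J → Z → ℝ} (hm : ∀ j, Measurable (h j))
    (tm : ∀ j, Measurable (t j)) (hint : ∀ j, Integrable (h j) μ)
    (hc : ∀ z j k, |h j z - h k z| ≤ |t j z - t k z|) (h0 : ∀ z j, |h j z| ≤ |t j z|)
    (hsym : ∀ a : J → ℝ, ∫⁻ z, ⨆ j, ENNReal.ofReal (Real.exp (a j - 2 * t j z)) ∂μ =
      ∫⁻ z, ⨆ j, ENNReal.ofReal (Real.exp (a j + 2 * t j z)) ∂μ) (a : J → ℝ) :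
    ∫⁻ z, ⨆ j, ENNReal.ofReal (Real.exp (a j + (∫ x, h j x ∂μ - h j z))) ∂μ ≤
      ∫⁻ z, ⨆ j, ENNReal.ofReal (Real.exp (a j + 2 * t j z)) ∂μ := by
  have hjensen : ∀ z, (⨆ j, ENNReal.ofReal (Real.exp (a j + (∫ x, h j x ∂μ - h j z)))) ≤
      ∫⁻ z', ⨆ j, ENNReal.ofReal (Real.exp (a j + (h j z' - h j z))) ∂μ := by
    intro z
    refine iSup_le fun j => ?_
    have hi : Integrable (fun x => h j x - h j z) μ := (hint j).sub (integrable_const _)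
    have h1 : a j + (∫ x, h j x ∂μ - h j z) = ∫ x, (a j + (h j x - h j z)) ∂μ := by
      rw [integral_add (integrable_const _) hi,
        integral_sub (hint j) (integrable_const _)]
      simp
    rw [h1]
    refine (ofReal_exp_integral_le
      ((integrable_const _).add ((hint j).sub (integrable_const _)))).trans ?_
    exact lintegral_mono fun z' =>
      le_iSup (fun j => ENNReal.ofReal (Real.exp (a j + (h j z' - h j z)))) j
  -- By convexity the sample and the ghost sample separate at the price of a factor `2`. Having the
  -- same law, they recombine at a single point with both signs, as if averaged over a Rademacher
  -- sign.
  have hsplit : ∀ z z', (⨆ j, ENNReal.ofReal (Real.exp (a j + (h j z' - h j z)))) ≤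
      2⁻¹ * ((⨆ j, ENNReal.ofReal (Real.exp (a j + 2 * h j z'))) +
        ⨆ j, ENNReal.ofReal (Real.exp (a j - 2 * h j z))) := by
    intro z z'
    refine iSup_le fun j => ?_
    refine le_trans ?_ (mul_le_mul_right (add_le_add
      (le_iSup (fun j => ENNReal.ofReal (Real.exp (a j + 2 * h j z'))) j)
      (le_iSup (fun j => ENNReal.ofReal (Real.exp (a j - 2 * h j z))) j)) _)
    have h2 : (2⁻¹ : ENNReal) = ENNReal.ofReal 2⁻¹ := by
      rw [ENNReal.ofReal_inv_of_pos (by norm_num)]; simp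
    rw [h2, ← ENNReal.ofReal_add (by positivity) (by positivity),
      ← ENNReal.ofReal_mul (by norm_num)]
    refine ENNReal.ofReal_le_ofReal ?_
    have hcv := convexOn_exp.2 (Set.mem_univ (a j + 2 * h j z')) (Set.mem_univ (a j - 2 * h j z))
      (by norm_num : (0 : ℝ) ≤ 2⁻¹) (by norm_num : (0 : ℝ) ≤ 2⁻¹) (by norm_num)
    simp only [smul_eq_mul] at hcv
    calc _ = Real.exp (2⁻¹ * (a j + 2 * h j z') + 2⁻¹ * (a j - 2 * h j z)) := by ring_nf
      _ ≤ _ := hcv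
      _ = _ := by ring
  have mp : ∀ f : J → Z → ℝ, (∀ j, Measurable (f j)) →
      Measurable fun z => ⨆ j, ENNReal.ofReal (Real.exp (a j + 2 * f j z)) := fun f hf =>
    Measurable.iSup fun j => (((hf j).const_mul 2).const_add _).exp.ennreal_ofReal
  have mm : ∀ f : J → Z → ℝ, (∀ j, Measurable (f j)) →
      Measurable fun z => ⨆ j, ENNReal.ofReal (Real.exp (a j - 2 * f j z)) := fun f hf =>
    Measurable.iSup fun j => (((hf j).const_mul 2).const_sub _).exp.ennreal_ofReal
  calc ∫⁻ z, ⨆ j, ENNReal.ofReal (Real.exp (a j + (∫ x, h j x ∂μ - h j z))) ∂μ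
      ≤ ∫⁻ z, ∫⁻ z', 2⁻¹ * ((⨆ j, ENNReal.ofReal (Real.exp (a j + 2 * h j z'))) +
        ⨆ j, ENNReal.ofReal (Real.exp (a j - 2 * h j z))) ∂μ ∂μ :=
        lintegral_mono fun z => (hjensen z).trans (lintegral_mono fun z' => hsplit z z')
    _ = 2⁻¹ * ∫⁻ z, ((⨆ j, ENNReal.ofReal (Real.exp (a j + 2 * h j z))) +
        ⨆ j, ENNReal.ofReal (Real.exp (a j - 2 * h j z))) ∂μ := by
        simp_rw [lintegral_const_mul' _ _ (by simp : (2⁻¹ : ENNReal) ≠ ⊤)]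
        rw [lintegral_add_left (mp h hm)]
        congr 1
        simp_rw [lintegral_add_left (mp h hm)]
        rw [lintegral_add_left measurable_const]
        simp
    _ ≤ 2⁻¹ * ∫⁻ z, ((⨆ j, ENNReal.ofReal (Real.exp (a j + 2 * t j z))) +
        ⨆ j, ENNReal.ofReal (Real.exp (a j - 2 * t j z))) ∂μ := by
        refine mul_le_mul_right (lintegral_mono fun z => ?_) _
        refine iSup_exp_add_iSup_exp_sub_le a (fun j => 2 * h j z) (fun j => 2 * t j z) ?_ ?_
        · intro j k
          rw [← mul_sub, ← mul_sub, abs_mul, abs_mul]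
          exact mul_le_mul_of_nonneg_left (hc z j k) (abs_nonneg _)
        · intro j
          rw [abs_mul, abs_mul]
          exact mul_le_mul_of_nonneg_left (h0 z j) (abs_nonneg _)
    _ = _ := by
        rw [lintegral_add_left (mp t tm), hsym, ← two_mul, ← mul_assoc,
          ENNReal.inv_mul_cancel (by simp) (by simp), one_mul]

theorem piFinSuccAbove_zero_symm_apply {m : ℕ} (z : Z) (S : Fin m → Z) :
    (MeasurableEquiv.piFinSuccAbove (fun _ : Fin (m + 1) => Z) 0).symm (z, S) = Fin.cons z S :=
  Fin.insertNth_zero' z S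

theorem lintegral_pi_succ {m : ℕ} {F : (Fin (m + 1) → Z) → ENNReal} (hF : Measurable F) :
    ∫⁻ S, F S ∂Measure.pi (fun _ : Fin (m + 1) => μ) =
      ∫⁻ z, ∫⁻ S, F (Fin.cons z S) ∂Measure.pi (fun _ : Fin m => μ) ∂μ := by
  have hmp := (measurePreserving_piFinSuccAbove (fun _ : Fin (m + 1) => μ) 0).symm
  rw [← hmp.lintegral_comp_emb (MeasurableEquiv.measurableEmbedding _), lintegral_prod]
  · simp only [piFinSuccAbove_zero_symm_apply]
  · exact (hF.comp (MeasurableEquiv.measurable _)).aemeasurable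

theorem measurable_cons {m : ℕ} :
    Measurable fun p : Z × (Fin m → Z) => (Fin.cons p.1 p.2 : Fin (m + 1) → Z) := by
  refine measurable_pi_lambda _ fun i => ?_
  refine Fin.cases ?_ (fun i => ?_) i
  · simpa using measurable_fst
  · simp only [Fin.cons_succ]
    fun_prop

/-- Symmetrization and contraction for a sample of size `m`. -/
theorem lintegral_pi_iSup_exp_le_of_contraction {h t : J → Z → ℝ} (hm : ∀ j, Measurable (h j))
    (tm : ∀ j, Measurable (t j)) (hint : ∀ j, Integrable (h j) μ)
    (hc : ∀ z j k, |h j z - h k z| ≤ |t j z - t k z|) (h0 : ∀ z j, |h j z| ≤ |t j z|)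
    (hsym : ∀ a : J → ℝ, ∫⁻ z, ⨆ j, ENNReal.ofReal (Real.exp (a j - 2 * t j z)) ∂μ =
      ∫⁻ z, ⨆ j, ENNReal.ofReal (Real.exp (a j + 2 * t j z)) ∂μ) (m : ℕ) (a : J → ℝ) :
    ∫⁻ S, ⨆ j, ENNReal.ofReal (Real.exp (a j + ∑ i, (∫ x, h j x ∂μ - h j (S i))))
        ∂Measure.pi (fun _ : Fin m => μ) ≤
      ∫⁻ S, ⨆ j, ENNReal.ofReal (Real.exp (a j + ∑ i, 2 * t j (S i)))
        ∂Measure.pi (fun _ : Fin m => μ) := by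
  induction m generalizing a with
  | zero => simp
  | succ m ih =>
    rw [lintegral_pi_succ (by fun_prop), lintegral_pi_succ (by fun_prop)]
    simp only [Fin.sum_univ_succ, Fin.cons_zero, Fin.cons_succ, ← add_assoc]
    -- Coordinates are replaced one at a time. The offset `a` absorbs the others, which is why it is
    -- general in the induction.
    calc _ ≤ ∫⁻ z, ∫⁻ S, ⨆ j, ENNReal.ofReal (Real.exp
          (a j + (∫ x, h j x ∂μ - h j z) + ∑ i, 2 * t j (S i)))
            ∂Measure.pi (fun _ : Fin m => μ) ∂μ :=
          lintegral_mono fun z => ih fun j => a j + (∫ x, h j x ∂μ - h j z)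
      _ = ∫⁻ S, ∫⁻ z, ⨆ j, ENNReal.ofReal (Real.exp
          (a j + (∫ x, h j x ∂μ - h j z) + ∑ i, 2 * t j (S i)))
            ∂μ ∂Measure.pi (fun _ : Fin m => μ) :=
          lintegral_lintegral_swap (by fun_prop)
      _ ≤ ∫⁻ S, ∫⁻ z, ⨆ j, ENNReal.ofReal (Real.exp
          (a j + 2 * t j z + ∑ i, 2 * t j (S i)))
            ∂μ ∂Measure.pi (fun _ : Fin m => μ) := by
          refine lintegral_mono fun S => ?_
          have := lintegral_iSup_exp_le_of_contraction hm tm hint hc h0 hsym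
            fun j => a j + ∑ i, 2 * t j (S i)
          simpa only [add_right_comm] using this
      _ = _ := lintegral_lintegral_swap (by fun_prop)

theorem lintegral_pi_exp_sum_le {g : Z → ℝ} (hg : Measurable g) {c : ℝ}
    (h : ∫⁻ z, ENNReal.ofReal (Real.exp (g z)) ∂μ ≤ ENNReal.ofReal (Real.exp c)) (m : ℕ) :
    ∫⁻ S, ENNReal.ofReal (Real.exp (∑ i, g (S i))) ∂Measure.pi (fun _ : Fin m => μ) ≤
      ENNReal.ofReal (Real.exp (m * c)) := by
  induction m with
  | zero => simp
  | succ m ih =>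
    rw [lintegral_pi_succ (by fun_prop)]
    simp only [Fin.sum_univ_succ, Fin.cons_zero, Fin.cons_succ, Real.exp_add,
      ENNReal.ofReal_mul (Real.exp_nonneg _)]
    simp_rw [lintegral_const_mul' _ _ ENNReal.ofReal_ne_top]
    rw [lintegral_mul_const' _ _ (ih.trans_lt ENNReal.ofReal_lt_top).ne]
    refine (mul_le_mul' h ih).trans (le_of_eq ?_)
    rw [← ENNReal.ofReal_mul (Real.exp_nonneg _), ← Real.exp_add]
    push_cast
    ring_nf

theorem lintegral_exp_tensorInner_gaussian {K : ℕ} {n : Fin K → ℕ} (W : Tensor n) :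
    ∫⁻ X : Tensor n, ENNReal.ofReal (Real.exp (tensorInner W X))
      ∂Measure.pi (fun _ => gaussianReal 0 1) =
      ENNReal.ofReal (Real.exp (tensorInner W W / 2)) := by
  have h1 : ∫ X : Tensor n, Real.exp (tensorInner W X) ∂Measure.pi (fun _ => gaussianReal 0 1) =
      Real.exp (tensorInner W W / 2) := by
    simp only [tensorInner, Real.exp_sum]
    rw [integral_fintype_prod_eq_prod (μ := fun _ => gaussianReal 0 1)
      (f := fun i x => Real.exp (W i * x)), Finset.sum_div, Real.exp_sum]
    refine Finset.prod_congr rfl fun i _ => ?_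
    have := congrFun (mgf_fun_id_gaussianReal (μ := 0) (v := 1)) (W i)
    rw [mgf] at this
    rw [this]
    congr 1
    simp [sq]
  rw [← h1, ofReal_integral_eq_lintegral_ofReal]
  -- A nonintegrable function would have Bochner integral `0`, but `h1` gives a positive value.
  · by_contra hcon
    rw [integral_undef hcon] at h1
    exact (Real.exp_pos _).ne h1
  · exact Filter.Eventually.of_forall fun _ => Real.exp_nonneg _

theorem integral_pi_succ {m : ℕ} {f : (Fin (m + 1) → Z) → ℝ}
    (hf : Integrable f (Measure.pi fun _ => μ)) :
    ∫ S, f S ∂Measure.pi (fun _ : Fin (m + 1) => μ) =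
      ∫ z, ∫ S, f (Fin.cons z S) ∂Measure.pi (fun _ : Fin m => μ) ∂μ := by
  have hmp := (measurePreserving_piFinSuccAbove (fun _ : Fin (m + 1) => μ) 0).symm
  rw [← hmp.integral_comp (MeasurableEquiv.measurableEmbedding _), integral_prod]
  · simp only [piFinSuccAbove_zero_symm_apply]
  · exact (hmp.integrable_comp_emb (MeasurableEquiv.measurableEmbedding _)).2 hf

/-- McDiarmid's inequality for the moment generating function (with a non-optimal constant). -/
theorem lintegral_exp_sub_integral_le_of_bounded_differences {m : ℕ} {f : (Fin m → Z) → ℝ}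
    (hf : Measurable f) {C c : ℝ} (hC : ∀ S, |f S| ≤ C)
    (hc : ∀ S i z, |f S - f (Function.update S i z)| ≤ c) (s : ℝ) :
    ∫⁻ S, ENNReal.ofReal (Real.exp (s * (f S - ∫ S', f S' ∂Measure.pi (fun _ => μ))))
      ∂Measure.pi (fun _ => μ) ≤ ENNReal.ofReal (Real.exp (m * (c ^ 2 * s ^ 2 / 2))) := by
  induction m with
  | zero =>
    have : ∀ S, f S = f (fun i => i.elim0) := fun S => congrArg f (Subsingleton.elim _ _)
    simp [this]
  | succ m ih =>
    have hint : ∀ {k : ℕ} {g : (Fin k → Z) → ℝ}, Measurable g → (∀ S, |g S| ≤ C) →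
        Integrable g (Measure.pi fun _ => μ) := fun hg hgC =>
      Integrable.of_bound hg.aestronglyMeasurable C (Filter.Eventually.of_forall hgC)
    have hmeas : Measurable fun p : Z × (Fin m → Z) => f (Fin.cons p.1 p.2) :=
      hf.comp measurable_cons
    have hmz : ∀ z, Measurable fun S : Fin m → Z => f (Fin.cons z S) := fun z =>
      hmeas.comp measurable_prodMk_left
    set F : Z → ℝ := fun z => ∫ S, f (Fin.cons z S) ∂Measure.pi (fun _ : Fin m => μ) with hF
    have hFm : Measurable F := hmeas.stronglyMeasurable.integral_prod_right.measurable
    have hFdiff : ∀ z w, |F z - F w| ≤ c := by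
      intro z w
      rw [hF]
      simp only
      rw [← integral_sub (hint (hmz z) fun S => hC _) (hint (hmz w) fun S => hC _)]
      have := norm_integral_le_of_norm_le_const (μ := Measure.pi fun _ : Fin m => μ) (C := c)
        (f := fun S => f (Fin.cons z S) - f (Fin.cons w S))
        (Filter.Eventually.of_forall fun S => by
          have := hc (Fin.cons z S) 0 w
          rwa [Fin.update_cons_zero] at this)
      simpa using this
    rw [lintegral_pi_succ (by fun_prop), integral_pi_succ (hint hf hC)]
    obtain ⟨z₀⟩ : Nonempty Z := nonempty_of_isProbabilityMeasure μ
    -- Conditional means given the first coordinate differ by at most `c`. The interval around `F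
    -- z₀` has length `2 * c`, so Hoeffding's lemma gives variance proxy `c ^ 2` instead of `c ^ 2 /
    -- 4`.
    have hhoeff := hasSubgaussianMGF_of_mem_Icc (μ := μ) (X := F) (a := F z₀ - c)
      (b := F z₀ + c) hFm.aemeasurable (Filter.Eventually.of_forall fun z => by
        have := abs_le.1 (hFdiff z z₀)
        constructor <;> linarith)
    have hmgf := hhoeff.mgf_le s
    have hval : ((((‖F z₀ + c - (F z₀ - c)‖₊ / 2) ^ 2 : ℝ≥0)) : ℝ) = c ^ 2 := by
      push_cast
      rw [Real.norm_eq_abs, div_pow, sq_abs]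
      ring
    rw [hval, mgf] at hmgf
    have hmgf' : ∫⁻ z, ENNReal.ofReal (Real.exp (s * (F z - ∫ z, F z ∂μ))) ∂μ ≤
        ENNReal.ofReal (Real.exp (c ^ 2 * s ^ 2 / 2)) := by
      rw [← ofReal_integral_eq_lintegral_ofReal (hhoeff.integrable_exp_mul s)
        (Filter.Eventually.of_forall fun _ => Real.exp_nonneg _)]
      exact ENNReal.ofReal_le_ofReal hmgf
    calc _ = ∫⁻ z, ENNReal.ofReal (Real.exp (s * (F z - ∫ z, F z ∂μ))) *
          ∫⁻ S, ENNReal.ofReal (Real.exp (s * (f (Fin.cons z S) - F z)))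
            ∂Measure.pi (fun _ : Fin m => μ) ∂μ := by
          refine lintegral_congr fun z => ?_
          rw [← lintegral_const_mul' _ _ ENNReal.ofReal_ne_top]
          refine lintegral_congr fun S => ?_
          rw [← ENNReal.ofReal_mul (Real.exp_nonneg _), ← Real.exp_add]
          congr 2
          simp only [hF]
          ring
      _ ≤ ∫⁻ z, ENNReal.ofReal (Real.exp (s * (F z - ∫ z, F z ∂μ))) *
          ENNReal.ofReal (Real.exp (m * (c ^ 2 * s ^ 2 / 2))) ∂μ := by
          refine lintegral_mono fun z => mul_le_mul_right ?_ _
          refine ih (hmz z) (fun S => hC _) fun S i w => ?_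
          have := hc (Fin.cons z S) i.succ w
          rwa [← Fin.cons_update] at this
      _ ≤ _ := by
          rw [lintegral_mul_const' _ _ ENNReal.ofReal_ne_top]
          refine (mul_le_mul_left hmgf' _).trans (le_of_eq ?_)
          rw [← ENNReal.ofReal_mul (Real.exp_nonneg _), ← Real.exp_add]
          push_cast
          ring_nf

/-- Chernoff's bound in terms of the Lebesgue integral. -/
theorem measure_lt_le_of_lintegral_exp_le {Ω : Type*} [MeasurableSpace Ω] {P : Measure Ω}
    {f : Ω → ℝ} (hf : Measurable f) {s b u δ : ℝ} (hs : 0 ≤ s)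
    (h : ∫⁻ ω, ENNReal.ofReal (Real.exp (s * f ω)) ∂P ≤ ENNReal.ofReal (Real.exp b))
    (hδ : Real.exp (b - s * u) ≤ δ) : P {ω | u < f ω} ≤ ENNReal.ofReal δ := by
  refine (measure_mono (t := {ω | ENNReal.ofReal (Real.exp (s * u)) ≤
    ENNReal.ofReal (Real.exp (s * f ω))}) fun ω hω => ENNReal.ofReal_le_ofReal
      (Real.exp_le_exp.2 (mul_le_mul_of_nonneg_left (le_of_lt hω) hs))).trans ?_
  refine (meas_ge_le_lintegral_div ((hf.const_mul s).exp.ennreal_ofReal.aemeasurable)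
    (by simp [Real.exp_pos]) ENNReal.ofReal_ne_top).trans ?_
  refine (ENNReal.div_le_div_right h _).trans ?_
  rw [← ENNReal.ofReal_div_of_pos (Real.exp_pos _), ← Real.exp_sub]
  exact ENNReal.ofReal_le_ofReal hδ

end TensorLearning

/-! ### Exponential moments of the deviation of the excess loss. -/

namespace TensorLearning

variable {K : ℕ} {n : Fin K → ℕ}

theorem tensorInner_neg_right (W X : Tensor n) : tensorInner W (-X) = -tensorInner W X := by
  simp [tensorInner]

theorem dualBound_neg (X : Tensor n) : dualBound (-X) = dualBound X := by
  refine iSup_congr fun o => ?_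
  rcases o with _ | k
  · simp [modeDualBound, frobeniusNorm, tensorInner]
  · have : unfolding k.1 (-X) = -unfolding k.1 X := rfl
    simp [modeDualBound, modeOpNorm, this]

theorem abs_tensorInner_le {D : ℝ} (hK : 0 < K) (hn : ∀ k, 0 < n k) {W : Tensor n}
    (hW : scaledLatentTraceNorm W ≤ D) (X : Tensor n) :
    |tensorInner W X| ≤ D * dualBound X := by
  have h : ∀ X, tensorInner W X ≤ D * dualBound X := fun X =>
    (tensorInner_le_mul_dualBound hK hn W X).trans
      (mul_le_mul_of_nonneg_right hW (dualBound_nonneg X))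
  refine abs_le.2 ⟨?_, h X⟩
  have := h (-X)
  rw [tensorInner_neg_right, dualBound_neg] at this
  linarith

theorem abs_tensorInner_sub_le {D : ℝ} (hK : 0 < K) (hn : ∀ k, 0 < n k) {W V : Tensor n}
    (hW : scaledLatentTraceNorm W ≤ D) (hV : scaledLatentTraceNorm V ≤ D) (X : Tensor n) :
    |tensorInner W X - tensorInner V X| ≤ 2 * D * dualBound X := by
  have h1 := abs_tensorInner_le hK hn hW X
  have h2 := abs_tensorInner_le hK hn hV X
  have h3 := abs_sub (tensorInner W X) (tensorInner V X)
  linarith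

theorem measurePreserving_neg_gaussian_pi :
    MeasurePreserving (fun X : Tensor n => -X) (Measure.pi fun _ => gaussianReal 0 1)
      (Measure.pi fun _ => gaussianReal 0 1) := by
  refine measurePreserving_pi (fun _ => gaussianReal 0 1) (fun _ => gaussianReal 0 1)
    (f := fun _ x => -x) fun _ => ⟨measurable_neg, ?_⟩
  have := gaussianReal_map_neg (μ := 0) (v := 1)
  simpa using this

variable {Y : Set ℝ} {μ : Measure (Tensor n × Y)}

theorem lintegral_fst_eq (hμ : HasStandardGaussianCovariate μ) {g : Tensor n → ENNReal}
    (hg : Measurable g) :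
    ∫⁻ z, g z.1 ∂μ = ∫⁻ X, g X ∂Measure.pi fun _ => gaussianReal 0 1 := by
  rw [← hμ, lintegral_map hg measurable_fst]

variable {l : ℝ → Y → ℝ} {Λ : ℝ≥0}

/-- The difference of the losses of `W` and of the reference tensor `W₀`. -/
noncomputable def excessLoss (l : ℝ → Y → ℝ) (W₀ W : Tensor n) (z : Tensor n × Y) : ℝ :=
  l (tensorInner W z.1) z.2 - l (tensorInner W₀ z.1) z.2

theorem measurable_loss (hl : Measurable (Function.uncurry l)) (W : Tensor n) :
    Measurable fun z : Tensor n × Y => l (tensorInner W z.1) z.2 :=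
  hl.comp (((measurable_tensorInner W).comp measurable_fst).prodMk measurable_snd)

theorem measurable_excessLoss (hl : Measurable (Function.uncurry l)) (W₀ W : Tensor n) :
    Measurable (excessLoss l W₀ W) :=
  (measurable_loss hl W).sub (measurable_loss hl W₀)

theorem integrable_excessLoss
    (hint : ∀ W : Tensor n, Integrable (fun z => l (tensorInner W z.1) z.2) μ)
    (W₀ W : Tensor n) : Integrable (excessLoss l W₀ W) μ :=
  (hint W).sub (hint W₀)

theorem integral_excessLoss
    (hint : ∀ W : Tensor n, Integrable (fun z => l (tensorInner W z.1) z.2) μ)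
    (W₀ W : Tensor n) : ∫ z, excessLoss l W₀ W z ∂μ = risk l μ W - risk l μ W₀ :=
  integral_sub (hint W) (hint W₀)

/-- The difference between the excess risk and the empirical excess risk, multiplied by the number
of samples. -/
noncomputable def excessDeviation (l : ℝ → Y → ℝ) (μ : Measure (Tensor n × Y)) (W₀ : Tensor n)
    {m : ℕ} (S : Fin m → Tensor n × Y) (W : Tensor n) : ℝ :=
  ∑ i, (∫ z, excessLoss l W₀ W z ∂μ - excessLoss l W₀ W (S i))

theorem measurable_excessDeviation (hl : Measurable (Function.uncurry l)) (W₀ W : Tensor n)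
    {m : ℕ} : Measurable fun S : Fin m → Tensor n × Y => excessDeviation l μ W₀ S W := by
  have := measurable_excessLoss hl W₀ W
  unfold excessDeviation
  fun_prop

theorem abs_loss_sub_le (hΛ : ∀ y, LipschitzWith Λ (fun u => l u y)) (W V : Tensor n)
    (z : Tensor n × Y) :
    |l (tensorInner W z.1) z.2 - l (tensorInner V z.1) z.2| ≤
      Λ * |tensorInner W z.1 - tensorInner V z.1| := by
  simpa [Real.dist_eq] using (hΛ z.2).dist_le_mul (tensorInner W z.1) (tensorInner V z.1)

/-- A bound of the exponential moments of the maximal deviation over a finite subset of a ball of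
the scaled latent trace norm. -/
theorem lintegral_iSup_exp_excessDeviation_le [IsProbabilityMeasure μ]
    (hK : 0 < K) (hn : ∀ k, 0 < n k) (hμ : HasStandardGaussianCovariate μ)
    (hl : Measurable (Function.uncurry l)) (hΛ : ∀ y, LipschitzWith Λ (fun u => l u y))
    (hint : ∀ W : Tensor n, Integrable (fun z => l (tensorInner W z.1) z.2) μ)
    {J : Type*} [Finite J] [Nonempty J] {W₀ : Tensor n} {W : J → Tensor n} {D : ℝ} (hD : 0 ≤ D)
    (hW₀ : scaledLatentTraceNorm W₀ ≤ D) (hW : ∀ j, scaledLatentTraceNorm (W j) ≤ D)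
    {L ν : ℝ} (hν : 1 ≤ ν) (hnν : ∀ k, (n k : ℝ) ≤ ν) (hL : ν + √(∏ j, (n j : ℝ)) ≤ L)
    {m : ℕ} (hm : 0 < m) {s : ℝ} (hs : 0 ≤ s) :
    ∫⁻ S, ⨆ j, ENNReal.ofReal (Real.exp (s * excessDeviation l μ W₀ S (W j)))
        ∂Measure.pi (fun _ : Fin m => μ) ≤
      ENNReal.ofReal (Real.exp (64 * L * Λ * D * √m * s +
        512 * ν * (Λ * D) ^ 2 * m * s ^ 2)) := by
  set h : J → Tensor n × Y → ℝ := fun j z => s * excessLoss l W₀ (W j) z with hh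
  -- The linear process dominating the losses by the Lipschitz property. It does not involve the
  -- label, so its symmetry follows from that of the Gaussian covariate.
  set t : J → Tensor n × Y → ℝ := fun j z => s * Λ * tensorInner (W j - W₀) z.1 with ht
  have hm0 : (0 : ℝ) < m := by exact_mod_cast hm
  have hsm : 0 < √(m : ℝ) := Real.sqrt_pos.2 hm0
  have htm : ∀ j, Measurable (t j) := fun j =>
    ((measurable_tensorInner _).comp measurable_fst).const_mul _
  have key : ∀ (U V : Tensor n) (z : Tensor n × Y), |s * (l (tensorInner U z.1) z.2 - l (tensorInner V z.1) z.2)| ≤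
      |s * Λ * (tensorInner U z.1 - tensorInner V z.1)| := by
    intro U V z
    rw [mul_assoc, abs_mul, abs_mul s, abs_mul, NNReal.abs_eq]
    exact mul_le_mul_of_nonneg_left (abs_loss_sub_le hΛ U V z) (abs_nonneg _)
  have hsym : ∀ a : J → ℝ, ∫⁻ z, ⨆ j, ENNReal.ofReal (Real.exp (a j - 2 * t j z)) ∂μ =
      ∫⁻ z, ⨆ j, ENNReal.ofReal (Real.exp (a j + 2 * t j z)) ∂μ := by
    intro a
    have hg : ∀ c : ℝ, Measurable fun X : Tensor n =>
        ⨆ j, ENNReal.ofReal (Real.exp (a j + c * tensorInner (W j - W₀) X)) := fun c =>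
      Measurable.iSup fun j =>
        (((measurable_tensorInner _).const_mul _).const_add _).exp.ennreal_ofReal
    have h1 := lintegral_fst_eq hμ (hg (-(2 * (s * Λ))))
    have h2 := lintegral_fst_eq hμ (hg (2 * (s * Λ)))
    have h3 := (measurePreserving_neg_gaussian_pi (n := n)).lintegral_comp (hg (2 * (s * Λ)))
    simp only [tensorInner_neg_right] at h3
    calc _ = ∫⁻ z, ⨆ j, ENNReal.ofReal
          (Real.exp (a j + -(2 * (s * Λ)) * tensorInner (W j - W₀) z.1)) ∂μ := by
          refine lintegral_congr fun z => iSup_congr fun j => ?_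
          rw [ht]; ring_nf
      _ = _ := h1
      _ = _ := by
          rw [← h3]
          refine lintegral_congr fun z => iSup_congr fun j => ?_
          ring_nf
      _ = _ := h2.symm
      _ = _ := by
          refine lintegral_congr fun z => iSup_congr fun j => ?_
          rw [ht]; ring_nf
  have hsymm := lintegral_pi_iSup_exp_le_of_contraction (μ := μ) (h := h) (t := t)
    (fun j => (measurable_excessLoss hl _ _).const_mul s) htm
    (fun j => (integrable_excessLoss hint _ _).const_mul s)
    (fun z j k => by
      have := key (W j) (W k) z
      simp only [hh, ht, excessLoss, tensorInner_sub_left]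
      convert this using 2 <;> ring)
    (fun z j => by
      simp only [hh, ht, excessLoss, tensorInner_sub_left]
      exact key (W j) W₀ z) hsym m 0
  -- The normalization keeps the sub-Gaussian parameter of a single covariate.
  set X : (Fin m → Tensor n × Y) → Tensor n := fun S => (√(m : ℝ))⁻¹ • ∑ i, (S i).1 with hX
  have hXm : Measurable X := by
    rw [hX]; fun_prop
  have hXinner : ∀ (V : Tensor n) S, tensorInner V (X S) =
      ∑ i, (√(m : ℝ))⁻¹ * tensorInner V (S i).1 := by
    intro V S
    rw [hX]
    simp only [tensorInner_smul_right]
    rw [← Finset.mul_sum]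
    congr 1
    simp only [tensorInner, Finset.sum_apply, Finset.mul_sum]
    exact Finset.sum_comm
  have hXmgf : ∀ V, ∫⁻ S, ENNReal.ofReal (Real.exp (tensorInner V (X S)))
      ∂Measure.pi (fun _ : Fin m => μ) ≤ ENNReal.ofReal (Real.exp (tensorInner V V / 2)) := by
    intro V
    simp only [hXinner]
    refine (lintegral_pi_exp_sum_le
      (g := fun z : Tensor n × Y => (√(m : ℝ))⁻¹ * tensorInner V z.1)
      (((measurable_tensorInner _).comp measurable_fst).const_mul _)
      (c := tensorInner V V / 2 / m) ?_ m).trans (le_of_eq ?_)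
    · have h1 := lintegral_exp_tensorInner_gaussian ((√(m : ℝ))⁻¹ • V)
      rw [← lintegral_fst_eq hμ (measurable_tensorInner _).exp.ennreal_ofReal] at h1
      simp only [tensorInner_smul_left, tensorInner_smul_right] at h1
      rw [h1]
      refine le_of_eq ?_
      congr 2
      have : (√(m : ℝ))⁻¹ * (√(m : ℝ))⁻¹ = (m : ℝ)⁻¹ := by
        rw [← mul_inv, Real.mul_self_sqrt hm0.le]
      rw [← mul_assoc, this]
      ring
    · congr 2
      field_simp
  -- The factor `4` combines `2` from symmetrization and `2` from `W j` and `W₀` both lying in the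
  -- ball of radius `D`.
  have hfinal := lintegral_exp_dualBound_le (P := Measure.pi (fun _ : Fin m => μ)) hXm hn hXmgf
    hν hnν hL (s := 4 * s * Λ * D * √m) (by positivity)
  calc _ = ∫⁻ S, ⨆ j, ENNReal.ofReal (Real.exp
        ((0 : J → ℝ) j + ∑ i, (∫ x, h j x ∂μ - h j (S i)))) ∂Measure.pi (fun _ : Fin m => μ) := by
        refine lintegral_congr fun S => iSup_congr fun j => ?_
        simp only [hh, integral_const_mul, excessDeviation, Finset.mul_sum, mul_sub,
          Pi.zero_apply, zero_add]
    _ ≤ _ := hsymm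
    _ ≤ ∫⁻ S, ENNReal.ofReal (Real.exp (4 * s * Λ * D * √m * dualBound (X S)))
        ∂Measure.pi (fun _ : Fin m => μ) := by
        refine lintegral_mono fun S => iSup_le fun j =>
          ENNReal.ofReal_le_ofReal (Real.exp_le_exp.2 ?_)
        have h1 : ∑ i, 2 * t j (S i) = 2 * s * Λ * √m * tensorInner (W j - W₀) (X S) := by
          rw [hXinner, Finset.mul_sum]
          refine Finset.sum_congr rfl fun i _ => ?_
          simp only [ht]
          field_simp
        rw [Pi.zero_apply, zero_add, h1, tensorInner_sub_left]
        have h2 := le_trans (le_abs_self _) (abs_tensorInner_sub_le hK hn (hW j) hW₀ (X S))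
        calc _ ≤ 2 * s * Λ * √m * (2 * D * dualBound (X S)) :=
              mul_le_mul_of_nonneg_left h2 (by positivity)
          _ = _ := by ring
    _ ≤ _ := hfinal
    _ = _ := by
        congr 2
        rw [mul_pow, Real.sq_sqrt hm0.le]
        ring

theorem integrable_abs_apply (hμ : HasStandardGaussianCovariate μ) (i : (k : Fin K) → Fin (n k)) :
    Integrable (fun z : Tensor n × Y => |z.1 i|) μ := by
  have h1 : Integrable (fun x : ℝ => |x|) (gaussianReal 0 1) :=
    (memLp_one_iff_integrable.1 (memLp_id_gaussianReal 1)).abs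
  have h2 : Integrable (fun X : Tensor n => |X i|) (Measure.pi fun _ => gaussianReal 0 1) :=
    (measurePreserving_eval (fun _ => gaussianReal 0 1) i).integrable_comp_of_integrable h1
  rw [← hμ] at h2
  exact h2.comp_measurable measurable_fst

theorem continuous_tensorInner_left (X : Tensor n) : Continuous fun W => tensorInner W X := by
  unfold tensorInner
  fun_prop

/-- The risk is Lipschitz, with constant governed by the first absolute moments of the entries.
Continuity allows passing from finite families to the whole ball. -/
theorem continuous_risk (hμ : HasStandardGaussianCovariate μ)
    (hΛ : ∀ y, LipschitzWith Λ (fun u => l u y))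
    (hint : ∀ W : Tensor n, Integrable (fun z => l (tensorInner W z.1) z.2) μ) :
    Continuous (risk l μ) := by
  set c := ∫ z : Tensor n × Y, Λ * ∑ i, |z.1 i| ∂μ with hc
  have hint' : Integrable (fun z : Tensor n × Y => Λ * ∑ i, |z.1 i|) μ :=
    (integrable_finsetSum _ fun i _ => integrable_abs_apply hμ i).const_mul _
  have hc0 : 0 ≤ c := integral_nonneg fun z => by positivity
  refine (LipschitzWith.of_dist_le_mul (K := c.toNNReal) fun W V => ?_).continuous
  rw [Real.dist_eq, risk, risk, ← integral_sub (hint W) (hint V), Real.coe_toNNReal _ hc0, hc,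
    ← integral_mul_const]
  refine (abs_integral_le_integral_abs).trans
    (integral_mono ((hint W).sub (hint V)).abs (hint'.mul_const _) fun z => ?_)
  refine (abs_loss_sub_le hΛ W V z).trans ?_
  rw [mul_assoc]
  refine mul_le_mul_of_nonneg_left ?_ Λ.2
  rw [← tensorInner_sub_left, tensorInner, Finset.sum_mul]
  refine (Finset.abs_sum_le_sum_abs _ _).trans (Finset.sum_le_sum fun i _ => ?_)
  rw [abs_mul, mul_comm]
  refine mul_le_mul_of_nonneg_left ?_ (abs_nonneg _)
  rw [Pi.sub_apply, ← Real.dist_eq]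
  exact dist_le_pi_dist W V i

theorem continuous_excessDeviation (hμ : HasStandardGaussianCovariate μ)
    (hΛ : ∀ y, LipschitzWith Λ (fun u => l u y))
    (hint : ∀ W : Tensor n, Integrable (fun z => l (tensorInner W z.1) z.2) μ) (W₀ : Tensor n)
    {m : ℕ} (S : Fin m → Tensor n × Y) : Continuous (excessDeviation l μ W₀ S) := by
  refine continuous_finsetSum _ fun i _ => Continuous.sub ?_ (Continuous.sub ?_ continuous_const)
  · simp only [integral_excessLoss hint]
    exact (continuous_risk hμ hΛ hint).sub continuous_const
  · exact (hΛ _).continuous.comp (continuous_tensorInner_left _)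

/-- A bound for the probability that some member of a continuous family exceeds a level follows from
the same bound for finite subfamilies. -/
theorem measure_exists_lt_le_of_forall_fin {Ω A : Type*} [MeasurableSpace Ω] {P : Measure Ω}
    [TopologicalSpace A] [TopologicalSpace.SeparableSpace A] [Nonempty A] {G : A → Ω → ℝ}
    (hG : ∀ ω, Continuous fun x => G x ω) {u : ℝ} {ε : ENNReal}
    (h : ∀ (k : ℕ) (x : Fin (k + 1) → A), P {ω | ∃ j, u < G (x j) ω} ≤ ε) :
    P {ω | ∃ x, u < G x ω} ≤ ε := by
  obtain ⟨x, hx⟩ := TopologicalSpace.exists_dense_seq A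
  have hsub : {ω | ∃ x, u < G x ω} ⊆ ⋃ k : ℕ, {ω | ∃ j : Fin (k + 1), u < G (x j) ω} := by
    rintro ω ⟨a, ha⟩
    obtain ⟨_, hy, ⟨k, rfl⟩⟩ := hx.inter_open_nonempty _
      (isOpen_lt continuous_const (hG ω)) ⟨a, ha⟩
    exact Set.mem_iUnion.2 ⟨k, ⟨Fin.last k, hy⟩⟩
  refine (measure_mono hsub).trans ?_
  have hmono : Monotone fun k : ℕ => {ω | ∃ j : Fin (k + 1), u < G (x j) ω} := by
    rintro k k' hk ω ⟨j, hj⟩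
    exact ⟨Fin.castLE (by omega) j, hj⟩
  rw [hmono.measure_iUnion]
  exact iSup_le fun k => h k fun j => x j

end TensorLearning

/-! ### Tails of the maximal deviation over a finite family. -/

namespace TensorLearning

section Chernoff

variable {Ω : Type*} [MeasurableSpace Ω] {P : Measure Ω}

/-- Chernoff's bound at the optimal parameter `s = r / (2 * b)`. -/
theorem measure_add_lt_le_of_forall_lintegral_exp_le {F : Ω → ℝ} (hF : Measurable F) {a b r ℓ : ℝ}
    (hb : 0 < b) (hr : 0 ≤ r) (hℓ : 4 * b * ℓ ≤ r ^ 2)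
    (h : ∀ s, 0 ≤ s → ∫⁻ ω, ENNReal.ofReal (Real.exp (s * F ω)) ∂P ≤
      ENNReal.ofReal (Real.exp (a * s + b * s ^ 2))) :
    P {ω | a + r < F ω} ≤ ENNReal.ofReal (Real.exp (-ℓ)) := by
  have hs : 0 ≤ r / (2 * b) := by positivity
  refine measure_lt_le_of_lintegral_exp_le hF hs (h _ hs) (Real.exp_le_exp.2 ?_)
  have : a * (r / (2 * b)) + b * (r / (2 * b)) ^ 2 - r / (2 * b) * (a + r) = -(r ^ 2 / (4 * b)) := by
    field_simp
    ring
  rw [this, neg_le_neg_iff, le_div_iff₀ (by positivity)]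
  linarith

theorem integral_le_of_lintegral_exp_le [IsProbabilityMeasure P] {F : Ω → ℝ} (hF : Integrable F P)
    {s c : ℝ} (hs : 0 < s)
    (h : ∫⁻ ω, ENNReal.ofReal (Real.exp (s * F ω)) ∂P ≤ ENNReal.ofReal (Real.exp (c * s))) :
    ∫ ω, F ω ∂P ≤ c := by
  have h1 := (ofReal_exp_integral_le (hF.const_mul s)).trans h
  rw [ENNReal.ofReal_le_ofReal_iff (Real.exp_nonneg _), Real.exp_le_exp, integral_const_mul,
    mul_comm c] at h1
  exact le_of_mul_le_mul_left h1 hs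

end Chernoff

variable {K : ℕ} {n : Fin K → ℕ} {Y : Set ℝ} {μ : Measure (Tensor n × Y)} {l : ℝ → Y → ℝ} {Λ : ℝ≥0}
  {J : Type*} [Finite J] {W₀ : Tensor n} {W : J → Tensor n} {m : ℕ}

/-- The maximum of the deviations over a finite family. -/
noncomputable def maxExcessDeviation (l : ℝ → Y → ℝ) (μ : Measure (Tensor n × Y)) (W₀ : Tensor n)
    (W : J → Tensor n) (S : Fin m → Tensor n × Y) : ℝ :=
  ⨆ j, excessDeviation l μ W₀ S (W j)

theorem excessDeviation_le_max (S : Fin m → Tensor n × Y) (j : J) :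
    excessDeviation l μ W₀ S (W j) ≤ maxExcessDeviation l μ W₀ W S :=
  le_ciSup (f := fun j => excessDeviation l μ W₀ S (W j)) (Set.finite_range _).bddAbove j

theorem exists_eq_maxExcessDeviation [Nonempty J] (S : Fin m → Tensor n × Y) :
    ∃ j, excessDeviation l μ W₀ S (W j) = maxExcessDeviation l μ W₀ W S :=
  exists_eq_ciSup_of_finite

theorem measurable_maxExcessDeviation (hl : Measurable (Function.uncurry l)) :
    Measurable (maxExcessDeviation l μ W₀ W : (Fin m → Tensor n × Y) → ℝ) :=
  Measurable.iSup fun j => measurable_excessDeviation hl W₀ (W j)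

theorem lintegral_exp_maxExcessDeviation_le [Nonempty J] [IsProbabilityMeasure μ]
    (hK : 0 < K) (hn : ∀ k, 0 < n k) (hμ : HasStandardGaussianCovariate μ)
    (hl : Measurable (Function.uncurry l)) (hΛ : ∀ y, LipschitzWith Λ (fun u => l u y))
    (hint : ∀ W : Tensor n, Integrable (fun z => l (tensorInner W z.1) z.2) μ)
    {D : ℝ} (hD : 0 ≤ D)
    (hW₀ : scaledLatentTraceNorm W₀ ≤ D) (hW : ∀ j, scaledLatentTraceNorm (W j) ≤ D)
    {L ν : ℝ} (hν : 1 ≤ ν) (hnν : ∀ k, (n k : ℝ) ≤ ν) (hL : ν + √(∏ j, (n j : ℝ)) ≤ L)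
    (hm : 0 < m) {s : ℝ} (hs : 0 ≤ s) :
    ∫⁻ S, ENNReal.ofReal (Real.exp (s * maxExcessDeviation l μ W₀ W S))
        ∂Measure.pi (fun _ : Fin m => μ) ≤
      ENNReal.ofReal (Real.exp (64 * L * Λ * D * √m * s +
        512 * ν * (Λ * D) ^ 2 * m * s ^ 2)) := by
  refine le_trans (lintegral_mono fun S => ?_) (lintegral_iSup_exp_excessDeviation_le hK hn hμ hl
    hΛ hint hD hW₀ hW hν hnν hL hm hs)
  obtain ⟨j, hj⟩ := exists_eq_maxExcessDeviation (l := l) (μ := μ) (W₀ := W₀) (W := W) S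
  rw [← hj]
  exact le_iSup (fun j => ENNReal.ofReal (Real.exp (s * excessDeviation l μ W₀ S (W j)))) j

/-- The tail of the maximal deviation for an arbitrary Lipschitz loss. -/
theorem measure_lt_maxExcessDeviation_le [Nonempty J] [IsProbabilityMeasure μ]
    (hK : 0 < K) (hn : ∀ k, 0 < n k) (hμ : HasStandardGaussianCovariate μ)
    (hl : Measurable (Function.uncurry l)) (hΛ : ∀ y, LipschitzWith Λ (fun u => l u y))
    (hint : ∀ W : Tensor n, Integrable (fun z => l (tensorInner W z.1) z.2) μ)
    {D : ℝ} (hD : 0 ≤ D) (hΛD : 0 < Λ * D)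
    (hW₀ : scaledLatentTraceNorm W₀ ≤ D) (hW : ∀ j, scaledLatentTraceNorm (W j) ≤ D)
    {L ν : ℝ} (hν : 1 ≤ ν) (hnν : ∀ k, (n k : ℝ) ≤ ν) (hL : ν + √(∏ j, (n j : ℝ)) ≤ L)
    (hm : 0 < m) {ℓ : ℝ} (hℓ : 0 ≤ ℓ) :
    Measure.pi (fun _ : Fin m => μ) {S | 64 * L * Λ * D * √m +
      m * (64 * (Λ * D * √ν) * √(ℓ / (2 * m))) < maxExcessDeviation l μ W₀ W S} ≤
      ENNReal.ofReal (Real.exp (-ℓ)) := by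
  have hm0 : (0 : ℝ) < m := by exact_mod_cast hm
  refine measure_add_lt_le_of_forall_lintegral_exp_le (measurable_maxExcessDeviation hl)
    (b := 512 * ν * (Λ * D) ^ 2 * m) (by positivity) (by positivity) (le_of_eq ?_) fun s hs =>
      lintegral_exp_maxExcessDeviation_le hK hn hμ hl hΛ hint hD hW₀ hW hν hnν hL hm hs
  have h1 : √ν ^ 2 = ν := Real.sq_sqrt (by linarith)
  have h2 : √(ℓ / (2 * m)) ^ 2 = ℓ / (2 * m) := Real.sq_sqrt (by positivity)
  -- The constant `64` is what makes `4 * b * ℓ = r ^ 2`, since `64 ^ 2 / 2 = 4 * 512`.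
  calc 4 * (512 * ν * (Λ * D) ^ 2 * m) * ℓ = (64 * m * (Λ * D)) ^ 2 * ν * (ℓ / (2 * m)) := by
        field_simp
        ring
    _ = (64 * m * (Λ * D)) ^ 2 * √ν ^ 2 * √(ℓ / (2 * m)) ^ 2 := by rw [h1, h2]
    _ = _ := by ring

/-- The tail of the maximal deviation for a loss with values in `[0, 1]`. -/
theorem measure_lt_maxExcessDeviation_le_of_mem_Icc [Nonempty J] [IsProbabilityMeasure μ]
    (hK : 0 < K) (hn : ∀ k, 0 < n k) (hμ : HasStandardGaussianCovariate μ)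
    (hl : Measurable (Function.uncurry l)) (hΛ : ∀ y, LipschitzWith Λ (fun u => l u y))
    (hint : ∀ W : Tensor n, Integrable (fun z => l (tensorInner W z.1) z.2) μ)
    (h01 : ∀ u y, l u y ∈ Set.Icc (0 : ℝ) 1)
    {D : ℝ} (hD : 0 ≤ D) (hΛD : 0 < Λ * D)
    (hW₀ : scaledLatentTraceNorm W₀ ≤ D) (hW : ∀ j, scaledLatentTraceNorm (W j) ≤ D)
    {L ν : ℝ} (hν : 1 ≤ ν) (hnν : ∀ k, (n k : ℝ) ≤ ν) (hL : ν + √(∏ j, (n j : ℝ)) ≤ L)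
    (hm : 0 < m) {ℓ : ℝ} (hℓ : 0 ≤ ℓ) :
    Measure.pi (fun _ : Fin m => μ) {S | 576 * L * Λ * D * √m +
      m * (64 * √(ℓ / (2 * m))) < maxExcessDeviation l μ W₀ W S} ≤
      ENNReal.ofReal (Real.exp (-ℓ)) := by
  have hm0 : (0 : ℝ) < m := by exact_mod_cast hm
  have hL0 : 0 < L := by linarith [Real.sqrt_nonneg (∏ j, (n j : ℝ))]
  have hloss : ∀ V z, |excessLoss l W₀ V z| ≤ 1 := by
    intro V z
    have h1 := h01 (tensorInner V z.1) z.2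
    have h2 := h01 (tensorInner W₀ z.1) z.2
    exact abs_le.2 ⟨by unfold excessLoss; linarith [h1.1, h2.2],
      by unfold excessLoss; linarith [h1.2, h2.1]⟩
  have hmean : ∀ V, |∫ z, excessLoss l W₀ V z ∂μ| ≤ 1 := by
    intro V
    simpa using norm_integral_le_of_norm_le_const (μ := μ) (C := 1) (f := excessLoss l W₀ V)
      (Filter.Eventually.of_forall (hloss V))
  have hbdd : ∀ S : Fin m → Tensor n × Y, |maxExcessDeviation l μ W₀ W S| ≤ m * 2 := by
    intro S
    obtain ⟨j, hj⟩ := exists_eq_maxExcessDeviation (l := l) (μ := μ) (W₀ := W₀) (W := W) S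
    rw [← hj, excessDeviation]
    refine (Finset.abs_sum_le_sum_abs _ _).trans
      ((Finset.sum_le_card_nsmul _ _ 2 fun i _ => ?_).trans (by simp))
    exact (abs_sub _ _).trans (by linarith [hmean (W j), hloss (W j) (S i)])
  have hupd : ∀ (S : Fin m → Tensor n × Y) i z V,
      excessDeviation l μ W₀ S V - excessDeviation l μ W₀ (Function.update S i z) V ≤ 2 ∧
      excessDeviation l μ W₀ (Function.update S i z) V - excessDeviation l μ W₀ S V ≤ 2 := by
    intro S i z V
    have h1 := abs_le.1 (hloss V z)
    have h2 := abs_le.1 (hloss V (S i))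
    have h3 : excessDeviation l μ W₀ S V - excessDeviation l μ W₀ (Function.update S i z) V =
        excessLoss l W₀ V z - excessLoss l W₀ V (S i) := by
      rw [excessDeviation, excessDeviation, ← Finset.sum_sub_distrib,
        Finset.sum_eq_single i (fun j _ hj => by simp [Function.update_of_ne hj]) (by simp)]
      simp
    constructor <;> linarith
  have hdiff : ∀ (S : Fin m → Tensor n × Y) i z,
      |maxExcessDeviation l μ W₀ W S - maxExcessDeviation l μ W₀ W (Function.update S i z)| ≤ 2 := by
    intro S i z
    obtain ⟨j, hj⟩ := exists_eq_maxExcessDeviation (l := l) (μ := μ) (W₀ := W₀) (W := W) S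
    obtain ⟨k, hk⟩ := exists_eq_maxExcessDeviation (l := l) (μ := μ) (W₀ := W₀) (W := W)
      (Function.update S i z)
    have h1 := excessDeviation_le_max (l := l) (μ := μ) (W₀ := W₀) (W := W)
      (Function.update S i z) j
    have h2 := excessDeviation_le_max (l := l) (μ := μ) (W₀ := W₀) (W := W) S k
    refine abs_le.2 ⟨?_, ?_⟩
    · linarith [(hupd S i z (W k)).2]
    · linarith [(hupd S i z (W j)).1]
  have hFm : Measurable (maxExcessDeviation l μ W₀ W : (Fin m → Tensor n × Y) → ℝ) :=
    measurable_maxExcessDeviation hl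
  have hFi : Integrable (maxExcessDeviation l μ W₀ W) (Measure.pi fun _ : Fin m => μ) :=
    Integrable.of_bound hFm.aestronglyMeasurable _ (Filter.Eventually.of_forall hbdd)
  set M := ∫ S, maxExcessDeviation l μ W₀ W S ∂Measure.pi (fun _ : Fin m => μ) with hM
  -- The chosen `s` turns the quadratic term into `512 * L * Λ * D * √m`, and `576 = 64 + 512`.
  have hMle : M ≤ 576 * L * Λ * D * √m := by
    refine integral_le_of_lintegral_exp_le hFi (s := L / (ν * (Λ * D) * √m)) (by positivity)
      ((lintegral_exp_maxExcessDeviation_le hK hn hμ hl hΛ hint hD hW₀ hW hν hnν hL hm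
        (by positivity)).trans (ENNReal.ofReal_le_ofReal (Real.exp_le_exp.2 (le_of_eq ?_))))
    have hΛ0 : (Λ : ℝ) ≠ 0 := fun h => by simp [h] at hΛD
    have hD0 : D ≠ 0 := fun h => by simp [h] at hΛD
    have hs : (m : ℝ) = √m * √m := (Real.mul_self_sqrt hm0.le).symm
    have hs0 : √(m : ℝ) ≠ 0 := (Real.sqrt_pos.2 hm0).ne'
    set r := √(m : ℝ)
    rw [hs]
    field_simp
    norm_num
  -- Excess losses lie in `[-1, 1]`, so the differences are at most `2` and the quadratic
  -- coefficient is `2 * m`. The factor `64` in the deviation is then far larger than needed.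
  have hmcd := lintegral_exp_sub_integral_le_of_bounded_differences (μ := μ) hFm hbdd hdiff
  refine (measure_mono (t := {S | 0 + m * (64 * √(ℓ / (2 * m))) <
    maxExcessDeviation l μ W₀ W S - M}) fun S hS => ?_).trans
    (measure_add_lt_le_of_forall_lintegral_exp_le (hFm.sub_const M) (b := 2 * m) (by positivity)
      (by positivity) ?_ fun s _ => (hmcd s).trans (le_of_eq ?_))
  · simp only [Set.mem_ofPred_eq] at hS ⊢
    linarith
  · rw [mul_pow, mul_pow, Real.sq_sqrt (by positivity)]
    have : (m : ℝ) ^ 2 * (64 ^ 2 * (ℓ / (2 * m))) = 2048 * (m * ℓ) := by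
      field_simp
      ring
    rw [this]
    nlinarith [mul_nonneg hm0.le hℓ]
  · ring_nf

end TensorLearning

/-! ### From the deviation to the excess risk. -/

namespace TensorLearning

variable {K : ℕ} {n : Fin K → ℕ} {Y : Set ℝ} {μ : Measure (Tensor n × Y)} {l : ℝ → Y → ℝ} {Λ : ℝ≥0}
  {W₀ : Tensor n} {m : ℕ}

theorem mul_risk_sub_le_excessDeviation
    (hint : ∀ W : Tensor n, Integrable (fun z => l (tensorInner W z.1) z.2) μ) (hm : 0 < m)
    {S : Fin m → Tensor n × Y} {W : Tensor n} (hW : empiricalRisk l S W ≤ empiricalRisk l S W₀) :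
    m * (risk l μ W - risk l μ W₀) ≤ excessDeviation l μ W₀ S W := by
  have hm0 : (0 : ℝ) < m := by exact_mod_cast hm
  have h1 := le_of_mul_le_mul_left hW (by positivity)
  have h2 : excessDeviation l μ W₀ S W = m * (risk l μ W - risk l μ W₀) -
      (∑ i, l (tensorInner W (S i).1) (S i).2 - ∑ i, l (tensorInner W₀ (S i).1) (S i).2) := by
    simp only [excessDeviation, integral_excessLoss hint]
    simp [excessLoss, Finset.sum_sub_distrib, mul_sub]
  linarith

/-- Covers the degenerate case `Λ * D = 0`, where the variance proxy vanishes and the tail bounds do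
not apply. -/
theorem risk_eq_of_mul_eq_zero (hK : 0 < K) (hn : ∀ k, 0 < n k)
    (hΛ : ∀ y, LipschitzWith Λ (fun u => l u y)) {D : ℝ} (hΛD : Λ * D = 0) {W V : Tensor n}
    (hW : scaledLatentTraceNorm W ≤ D) (hV : scaledLatentTraceNorm V ≤ D) :
    risk l μ W = risk l μ V := by
  refine integral_congr_ae (Filter.Eventually.of_forall fun z => ?_)
  have h1 := abs_loss_sub_le hΛ W V z
  have h2 := mul_le_mul_of_nonneg_left (abs_tensorInner_sub_le hK hn hW hV z.1) Λ.2
  have h3 : (Λ : ℝ) * (2 * D * dualBound z.1) = 0 := by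
    rw [show (Λ : ℝ) * (2 * D * dualBound z.1) = Λ * D * (2 * dualBound z.1) by ring, hΛD, zero_mul]
  have h4 := abs_nonneg (l (tensorInner W z.1) z.2 - l (tensorInner V z.1) z.2)
  have h5 : |l (tensorInner W z.1) z.2 - l (tensorInner V z.1) z.2| = 0 :=
    le_antisymm (h1.trans (h2.trans h3.le)) h4
  exact sub_eq_zero.1 (abs_eq_zero.1 h5)

/-- The deviation is a sum over samples, hence the factor `m`, and `m * √(1 / m) = √m`. The term
with `√(2 * log K)` is nonnegative and is dropped. -/
theorem le_mul_excessRiskBound {c₁ c₂ B δ : ℝ} (hc₁ : 0 ≤ c₁) (hB : 0 ≤ B) (hm : 0 < m) :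
    c₁ * (⨆ k, ((n k : ℝ) + √(∏ j, (n j : ℝ)))) * Λ * (B * sqrtMinRelativeRank W₀) * √m +
      m * (c₂ * √(Real.log (2 / δ) / (2 * m))) ≤ m * excessRiskBound c₁ c₂ 1 Λ B W₀ m δ := by
  have hm0 : (0 : ℝ) < m := by exact_mod_cast hm
  have h1 : (m : ℝ) * √(1 / (m : ℝ) * ⨅ k, (modeRank k W₀ : ℝ) / (n k : ℝ)) =
      √m * sqrtMinRelativeRank W₀ := by
    rw [Real.sqrt_mul (by positivity), Real.sqrt_div zero_le_one, Real.sqrt_one,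
      sqrtMinRelativeRank]
    nth_rw 1 [← Real.mul_self_sqrt hm0.le]
    have : √(m : ℝ) ≠ 0 := (Real.sqrt_pos.2 hm0).ne'
    field_simp
  have h2 : 0 ≤ c₁ * Λ * B * (√m * sqrtMinRelativeRank W₀) * √(2 * Real.log K) := by
    have : 0 ≤ sqrtMinRelativeRank W₀ := Real.sqrt_nonneg _
    positivity
  have h3 : m * excessRiskBound c₁ c₂ 1 Λ B W₀ m δ = c₁ * Λ * B *
      (m * √(1 / (m : ℝ) * ⨅ k, (modeRank k W₀ : ℝ) / (n k : ℝ))) *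
      ((⨆ k, ((n k : ℝ) + √(∏ j, (n j : ℝ)))) + 1 * √(2 * Real.log K)) +
      m * (c₂ * √(Real.log (2 / δ) / (2 * m))) := by
    rw [excessRiskBound]
    ring
  rw [h3, h1]
  linarith

/-- Since `What S` depends on the sample, the deviation has to be controlled uniformly over the
ball. Monotonicity of the outer measure suffices, so `What` may be any selection of minimizers,
measurable or not. -/
theorem measure_not_risk_sub_le_le [IsProbabilityMeasure μ] (hμ : HasStandardGaussianCovariate μ)
    (hΛ : ∀ y, LipschitzWith Λ (fun u => l u y))
    (hint : ∀ W : Tensor n, Integrable (fun z => l (tensorInner W z.1) z.2) μ) (hm : 0 < m)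
    {B₀ u v : ℝ} (hW₀ : scaledLatentTraceNorm W₀ ≤ B₀)
    {What : (Fin m → Tensor n × Y) → Tensor n}
    (hWhat : ∀ S, IsConstrainedMinimizer (empiricalRisk l S) B₀ (What S)) {ε : ENNReal}
    (huv : u ≤ m * v)
    (h : ∀ (k : ℕ) (W : Fin (k + 1) → Tensor n), (∀ j, scaledLatentTraceNorm (W j) ≤ B₀) →
      Measure.pi (fun _ : Fin m => μ) {S | u < maxExcessDeviation l μ W₀ W S} ≤ ε) :
    Measure.pi (fun _ : Fin m => μ) {S | ¬ risk l μ (What S) - risk l μ W₀ ≤ v} ≤ ε := by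
  have hm0 : (0 : ℝ) < m := by exact_mod_cast hm
  have : Nonempty {V : Tensor n // scaledLatentTraceNorm V ≤ B₀} := ⟨⟨W₀, hW₀⟩⟩
  refine (measure_mono fun S hS => ?_).trans (measure_exists_lt_le_of_forall_fin
    (P := Measure.pi fun _ : Fin m => μ)
    (G := fun (V : {V : Tensor n // scaledLatentTraceNorm V ≤ B₀}) S =>
      excessDeviation l μ W₀ S V.1) (u := u) (ε := ε)
    (fun S => (continuous_excessDeviation hμ hΛ hint W₀ S).comp continuous_subtype_val)
    fun k W => (measure_mono ?_).trans (h k (fun j => (W j).1) fun j => (W j).2))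
  · refine ⟨⟨What S, (hWhat S).1⟩, ?_⟩
    have h1 := mul_risk_sub_le_excessDeviation hint hm ((hWhat S).2 W₀ hW₀)
    have h2 := mul_lt_mul_of_pos_left (not_le.1 hS) hm0
    exact huv.trans_lt (h2.trans_le h1)
  · rintro S ⟨j, hj⟩
    exact lt_of_lt_of_le hj (excessDeviation_le_max (W := fun j => (W j).1) S j)

end TensorLearning

open TensorLearning in
theorem TensorLearning.excess_risk_bounds {K : ℕ} {n : Fin K → ℕ} (hK : 0 < K)
    (hn : ∀ k, 0 < n k) {Y : Set ℝ} {μ : Measure (Tensor n × Y)} [IsProbabilityMeasure μ]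
    (hμ : HasStandardGaussianCovariate μ) {l : ℝ → Y → ℝ} {Λ : ℝ≥0}
    (hl : Measurable (Function.uncurry l)) (hΛ : ∀ y, LipschitzWith Λ (fun u => l u y))
    (hint : ∀ W : Tensor n, Integrable (fun z => l (tensorInner W z.1) z.2) μ)
    {B B₀ : ℝ} {W₀ : Tensor n} (hW₀ : scaledLatentTraceNorm W₀ ≤ B₀)
    (hB : frobeniusNorm W₀ ≤ B) (hB₀ : B₀ ≤ B * sqrtMinRelativeRank W₀)
    {m : ℕ} (hm : 0 < m) {What : (Fin m → Tensor n × Y) → Tensor n}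
    (hWhat : ∀ S, IsConstrainedMinimizer (empiricalRisk l S) B₀ (What S))
    {δ : ℝ} (hδ0 : 0 < δ) (hδ1 : δ < 1) :
    ((∀ u y, l u y ∈ Set.Icc (0 : ℝ) 1) →
      Measure.pi (fun _ : Fin m => μ) {S | ¬ risk l μ (What S) - risk l μ W₀ ≤
        excessRiskBound 576 64 1 Λ B W₀ m δ} ≤ ENNReal.ofReal δ) ∧
    Measure.pi (fun _ : Fin m => μ) {S | ¬ risk l μ (What S) - risk l μ W₀ ≤
      excessRiskBound 576 (64 * (Λ * B * √(⨆ k, (n k : ℝ)) * sqrtMinRelativeRank W₀)) 1 Λ B W₀ m δ} ≤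
      ENNReal.ofReal δ := by
  have hm0 : (0 : ℝ) < m := by exact_mod_cast hm
  have hB' : 0 ≤ B := (frobeniusNorm_nonneg W₀).trans hB
  have hsq : 0 ≤ sqrtMinRelativeRank W₀ := Real.sqrt_nonneg _
  set D := B * sqrtMinRelativeRank W₀ with hD
  have hD0 : 0 ≤ D := mul_nonneg hB' hsq
  set L := ⨆ k, ((n k : ℝ) + √(∏ j, (n j : ℝ))) with hL
  set ν := ⨆ k, (n k : ℝ) with hν
  have : Nonempty (Fin K) := ⟨⟨0, hK⟩⟩
  have hnν : ∀ k, (n k : ℝ) ≤ ν := fun k =>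
    le_ciSup (f := fun k => (n k : ℝ)) (Set.finite_range _).bddAbove k
  have hν1 : 1 ≤ ν := le_trans (by exact_mod_cast hn ⟨0, hK⟩) (hnν ⟨0, hK⟩)
  have hνL : ν + √(∏ j, (n j : ℝ)) ≤ L := by
    obtain ⟨k, hk⟩ := exists_eq_ciSup_of_finite (f := fun k => (n k : ℝ))
    rw [hν, ← hk]
    exact le_ciSup (f := fun k => (n k : ℝ) + √(∏ j, (n j : ℝ))) (Set.finite_range _).bddAbove k
  have hL0 : 0 ≤ L := by linarith [Real.sqrt_nonneg (∏ j, (n j : ℝ))]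
  have hℓ : 0 ≤ Real.log (2 / δ) := Real.log_nonneg (by rw [le_div_iff₀ hδ0]; linarith)
  -- The left-hand side is `δ / 2`: one tail event suffices, and the `2` in the logarithm is slack.
  have hexp : ENNReal.ofReal (Real.exp (-Real.log (2 / δ))) ≤ ENNReal.ofReal δ := by
    refine ENNReal.ofReal_le_ofReal ?_
    rw [Real.exp_neg, Real.exp_log (by positivity), inv_div]
    linarith
  have hbound : ∀ c₂, 576 * L * Λ * D * √m + m * (c₂ * √(Real.log (2 / δ) / (2 * m))) ≤
      m * excessRiskBound 576 c₂ 1 Λ B W₀ m δ := fun c₂ =>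
    le_mul_excessRiskBound (by norm_num) hB' hm
  have hfeas : ∀ {W : Tensor n}, scaledLatentTraceNorm W ≤ B₀ → scaledLatentTraceNorm W ≤ D :=
    fun h => h.trans hB₀
  rcases (mul_nonneg Λ.2 hD0).eq_or_lt with h0 | hΛD
  · have hempty : ∀ c₂, 0 ≤ c₂ → Measure.pi (fun _ : Fin m => μ)
        {S | ¬ risk l μ (What S) - risk l μ W₀ ≤ excessRiskBound 576 c₂ 1 Λ B W₀ m δ} ≤
          ENNReal.ofReal δ := by
      intro c₂ hc₂
      have hpos : 0 ≤ m * excessRiskBound 576 c₂ 1 Λ B W₀ m δ :=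
        le_trans (by positivity) (hbound c₂)
      have hpos' := nonneg_of_mul_nonneg_right hpos hm0
      have : {S | ¬ risk l μ (What S) - risk l μ W₀ ≤ excessRiskBound 576 c₂ 1 Λ B W₀ m δ} = ∅ := by
        refine Set.eq_empty_of_forall_notMem fun S hS => hS ?_
        rw [risk_eq_of_mul_eq_zero hK hn hΛ h0.symm (hfeas (hWhat S).1) (hfeas hW₀), sub_self]
        exact hpos'
      rw [this, measure_empty]
      exact zero_le
    exact ⟨fun _ => hempty 64 (by norm_num), hempty _ (by positivity)⟩
  · refine ⟨fun h01 => ?_, ?_⟩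
    · refine measure_not_risk_sub_le_le hμ hΛ hint hm hW₀ hWhat (hbound 64) fun k W hW => ?_
      exact (measure_lt_maxExcessDeviation_le_of_mem_Icc hK hn hμ hl hΛ hint h01 hD0 hΛD
        (hfeas hW₀) (fun j => hfeas (hW j)) hν1 hnν hνL hm hℓ).trans hexp
    · refine measure_not_risk_sub_le_le hμ hΛ hint hm hW₀ hWhat (u := 64 * L * Λ * D * √m +
        m * (64 * (Λ * D * √ν) * √(Real.log (2 / δ) / (2 * m)))) ?_ fun k W hW => ?_
      · refine le_trans ?_ (hbound _)
        have h1 : (Λ : ℝ) * D * √ν = Λ * B * √ν * sqrtMinRelativeRank W₀ := by rw [hD]; ring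
        rw [h1]
        have h2 : 0 ≤ L * Λ * D * √m := by positivity
        linarith
      · exact (measure_lt_maxExcessDeviation_le hK hn hμ hl hΛ hint hD0 hΛD
          (hfeas hW₀) (fun j => hfeas (hW j)) hν1 hnν hνL hm hℓ).trans hexp

theorem theorem3 :
    ∃ c₁ c₂ C : ℝ, 0 < c₁ ∧ 0 < c₂ ∧ 0 < C ∧
      ∀ (K : ℕ) (n : Fin K → ℕ), 0 < K → (∀ k, 0 < n k) →
      ∀ (Y : Set ℝ) (μ : Measure (TensorLearning.Tensor n × Y)) [IsProbabilityMeasure μ],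
        TensorLearning.HasStandardGaussianCovariate μ →
      ∀ (l : ℝ → Y → ℝ) (Λ : ℝ≥0),
        Measurable (Function.uncurry l) → (∀ y, LipschitzWith Λ (fun u => l u y)) →
        (∀ W : TensorLearning.Tensor n,
          Integrable (fun z => l (TensorLearning.tensorInner W z.1) z.2) μ) →
      ∀ (B B₀ : ℝ) (W₀ : TensorLearning.Tensor n),
        TensorLearning.IsConstrainedMinimizer (TensorLearning.risk l μ) B₀ W₀ →
        TensorLearning.frobeniusNorm W₀ ≤ B →
        B₀ ≤ B * TensorLearning.sqrtMinRelativeRank W₀ →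
      ∀ (m : ℕ), 0 < m →
      ∀ What : (Fin m → TensorLearning.Tensor n × Y) → TensorLearning.Tensor n,
        (∀ S, TensorLearning.IsConstrainedMinimizer
          (TensorLearning.empiricalRisk l S) B₀ (What S)) →
      ∀ δ : ℝ, 0 < δ → δ < 1 →
        -- for a loss with values in `[0, 1]`, the constants are all absolute
        ((∀ u y, l u y ∈ Set.Icc (0 : ℝ) 1) →
          Measure.pi (fun _ : Fin m => μ)
            {S | ¬ TensorLearning.risk l μ (What S) - TensorLearning.risk l μ W₀ ≤
              TensorLearning.excessRiskBound c₁ c₂ C Λ B W₀ m δ} ≤ ENNReal.ofReal δ) ∧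
        -- for an arbitrary Lipschitz loss, the last constant carries the scale of the problem
        Measure.pi (fun _ : Fin m => μ)
          {S | ¬ TensorLearning.risk l μ (What S) - TensorLearning.risk l μ W₀ ≤
            TensorLearning.excessRiskBound c₁
              (c₂ * (Λ * B * √(⨆ k, (n k : ℝ)) * TensorLearning.sqrtMinRelativeRank W₀))
              C Λ B W₀ m δ} ≤ ENNReal.ofReal δ := by
  refine ⟨576, 64, 1, by norm_num, by norm_num, by norm_num, ?_⟩
  intro K n hK hn Y μ _ hμ l Λ hl hΛ hint B B₀ W₀ hW₀ hB hB₀ m hm What hWhat δ hδ0 hδ1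
  exact TensorLearning.excess_risk_bounds hK hn hμ hl hΛ hint hW₀.1 hB hB₀ hm hWhat hδ0 hδ1
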